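/- Let $d\ge 2$ and $m>1$ be integers, let $c_m=1/\cos(\pi/(2m))$, and let $B_d=\{x\in\mathbb{R}^d:\|x\|_2\le 1\}$. For $k\ge 1$ let $\mathcal{C}_k$ denote either the $k$ Chebyshev points $\cos((2j-1)\pi/(2k))$, $1\le j\le k$ (for all $k$), or the $k+1$ Chebyshev-Lobatto points $\cos(j\pi/k)$, $0\le j\le k$ (for all $k$). For $a<b\le a+2\pi$ and $u\in[-1,1]$ put $\sigma_{a,b}(u)=2\arcsin\left(\sin\left(\frac{b-a}{4}\right)u\right)+\frac{a+b}{2}$, and define $$\mathcal{U}(u_1,\dots,u_d)=\left(\tfrac{u_1}{2}+\tfrac12,\ \sigma_{0,\pi}(u_2),\dots,\sigma_{0,\pi}(u_{d-1}),\ \sigma_{0,2\pi}(u_d)\right),\qquad u\in[-1,1]^d .$$ Let $\mathcal{G}:[0,1]\times[0,\pi]^{d-2}\times[0,2\pi]\to B_d$, $\mathcal{G}(r,\theta_1,\dots,\theta_{d-1})=x$, be the generalized spherical coordinates $$x_j=r\cos(\theta_j)\prod_{k=1}^{j-1}\sin(\theta_k)\quad(1\le j\le d-1),\qquad x_d=r\prod_{k=1}^{d-1}\sin(\theta_k),$$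 and put $\mathcal{S}=\mathcal{G}\circ\mathcal{U}:[-1,1]^d\to B_d$. Then the sequence $X_n^m=\mathcal{S}\left(\mathcal{C}_{mn}\times(\mathcal{C}_{2mn})^{d-1}\right)$, $n=1,2,\dots$, is an admissible polynomial mesh for $B_d$ with constant $c=(c_m)^d$. That is: $B_d$ is compact and polynomially determining (a polynomial vanishing on $B_d$ vanishes everywhere); each $X_n^m$, $n\ge1$, is a nonempty finite subset of $B_d$; for every $n\ge 1$ and every real polynomial $p$ in $d$ variables of total degree at most $n$, $$\max_{x\in B_d}|p(x)|\le (c_m)^d\max_{x\in X_n^m}|p(x)|;$$ and there is a real $\alpha\ge d$ with $\operatorname{card}(X_n^m)=O(n^\alpha)$ as $n\to\infty$ (for fixed $d$ and $m$). -/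

import Mathlib

open scoped BigOperators

namespace BallMesh

/-- The sup-norm `‖f‖_Y` of a real function over a set `Y`. It is only used for continuous `f`
and nonempty `Y` that is compact (in particular finite), so that the supremum is attained. -/
noncomputable def supNorm {E : Type*} (Y : Set E) (f : E → ℝ) : ℝ :=
  sSup ((fun x => |f x|) '' Y)

/-- The polynomial function on `ℝ^d` of a `d`-variate real polynomial. -/
noncomputable def polyFun {d : ℕ} (p : MvPolynomial (Fin d) ℝ) (x : EuclideanSpace ℝ (Fin d)) : ℝ :=
  MvPolynomial.eval (fun i => x i) p

/-- `K` is polynomially determining: a polynomial vanishing on `K` vanishes everywhere. -/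
def IsPolynomiallyDetermining {d : ℕ} (K : Set (EuclideanSpace ℝ (Fin d))) : Prop :=
  ∀ p : MvPolynomial (Fin d) ℝ,
    (∀ x ∈ K, polyFun p x = 0) → ∀ x : EuclideanSpace ℝ (Fin d), polyFun p x = 0

/-- The sequence `X 1, X 2, …` is a polynomial admissible mesh of `K ⊆ ℝ^d` with constant `c`. -/
structure IsAdmissibleMesh {d : ℕ} (K : Set (EuclideanSpace ℝ (Fin d)))
    (X : ℕ → Set (EuclideanSpace ℝ (Fin d))) (c : ℝ) : Prop where
  isCompact : IsCompact K
  determining : IsPolynomiallyDetermining K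
  finite : ∀ n, 1 ≤ n → (X n).Finite
  nonempty : ∀ n, 1 ≤ n → (X n).Nonempty
  subset : ∀ n, 1 ≤ n → X n ⊆ K
  norming : ∀ n, 1 ≤ n → ∀ p : MvPolynomial (Fin d) ℝ, p.totalDegree ≤ n →
    supNorm K (polyFun p) ≤ c * supNorm (X n) (polyFun p)
  card_isBigO : ∃ α : ℝ, (d : ℝ) ≤ α ∧
    Asymptotics.IsBigO Filter.atTop (fun n : ℕ => ((X n).ncard : ℝ)) (fun n : ℕ => (n : ℝ) ^ α)

/-- The `k` Chebyshev zeros in `(-1,1)`. -/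
noncomputable def chebyshevPoints (k : ℕ) : Set ℝ :=
  {x | ∃ j : ℕ, 1 ≤ j ∧ j ≤ k ∧ x = Real.cos ((2 * (j : ℝ) - 1) * Real.pi / (2 * (k : ℝ)))}

/-- The `k + 1` Chebyshev extrema in `[-1,1]`. -/
noncomputable def chebyshevLobattoPoints (k : ℕ) : Set ℝ :=
  {x | ∃ j : ℕ, j ≤ k ∧ x = Real.cos ((j : ℝ) * Real.pi / (k : ℝ))}

/-- The constant `c_m = 1 / cos (π / (2m))`, for `m > 1`. -/
noncomputable def meshConst (m : ℕ) : ℝ :=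
  1 / Real.cos (Real.pi / (2 * (m : ℝ)))

/-- The map `σ_{a,b} : [-1,1] → [a,b]`. -/
noncomputable def sigma (a b u : ℝ) : ℝ :=
  2 * Real.arcsin (Real.sin ((b - a) / 4) * u) + (b + a) / 2

/-- Generalized spherical coordinates, for `d ≥ 2`. Indices start at `0`: `t 0` is the radius `r`
and `t k`, for `1 ≤ k ≤ d - 1`, is the angle `θ_k`. The coordinate with index `i` is
`r * sin θ_1 * ⋯ * sin θ_i * cos θ_{i+1}` for `i < d - 1`, and for the last index `i = d - 1` it is
`r * sin θ_1 * ⋯ * sin θ_{d-1}`. -/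
noncomputable def sphericalMap {d : ℕ} [NeZero d] (t : Fin d → ℝ) : EuclideanSpace ℝ (Fin d) :=
  WithLp.toLp 2 fun i : Fin d =>
    t 0 * (∏ k ∈ Finset.Ioc 0 i, Real.sin (t k)) *
      (if h : i.val + 1 < d then Real.cos (t ⟨i.val + 1, h⟩) else 1)

/-- The map `U(u_1, …, u_d) = (u_1 / 2 + 1 / 2, σ_{0,π}(u_2), …, σ_{0,π}(u_{d-1}), σ_{0,2π}(u_d))`
(with indices starting at `0`). -/
noncomputable def boxMap {d : ℕ} [NeZero d] (u : Fin d → ℝ) : Fin d → ℝ := fun k =>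
  if k = 0 then u k / 2 + 1 / 2
  else if k.val + 1 < d then sigma 0 Real.pi (u k)
  else sigma 0 (2 * Real.pi) (u k)

/-- The composed transformation `S = G ∘ U` from `[-1,1]^d` to the ball. -/
noncomputable def ballMap {d : ℕ} [NeZero d] (u : Fin d → ℝ) : EuclideanSpace ℝ (Fin d) :=
  sphericalMap (boxMap u)

/-- The product grid `A × B^(d-1)` in `ℝ^d`. -/
def productGrid {d : ℕ} [NeZero d] (A B : Set ℝ) : Set (Fin d → ℝ) :=
  {u | u 0 ∈ A ∧ ∀ k : Fin d, k ≠ 0 → u k ∈ B}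

/-- The transformed grid `S(C_{mn} × (C_{2mn})^(d-1))`. -/
def ballMesh (d : ℕ) [NeZero d] (C : ℕ → Set ℝ) (m n : ℕ) : Set (EuclideanSpace ℝ (Fin d)) :=
  ballMap '' productGrid (C (m * n)) (C (2 * m * n))

end BallMesh

/-! With all but one coordinate of the cube frozen, `polyFun p ∘ ballMap` becomes a function of one
variable `y = cos x`: a polynomial of degree at most `n` in the radial case, a trigonometric
polynomial of degree at most `n` on an arc or on the circle in the angular case. If `F x` denotes
this function, a Bernstein–Szegő inequality `F' ^ 2 ≤ N ^ 2 * (M ^ 2 - F ^ 2)` holds whenever `|F| ≤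
M`, with `N = n` for the radius and `N = 2 * n` for an angle. Hence `arcsin (F / M)` is
`N`-Lipschitz, and `|F|` is at least `M * cos (π / (2 * m))` within distance `π / (2 * m * N)` of a
point where `|F| = M`. The Chebyshev nodes of order `m * N` are that dense in the variable `x`, so
moving one coordinate to a node costs a factor `meshConst m`; doing so for all `d` coordinates gives
the constant, as `ballMap` covers the ball.

The Bernstein–Szegő inequality comes uniformly from complex growth. If `T_k (f z / M)` is at most `C
* exp (k * N * |Im z|)` for every `k`, then letting `k → ∞` removes `C` and places `f z / M` in an
ellipse with semi-axes `cosh (N * Im z)` and `sinh (N * Im z)`; letting `z` approach the real line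
gives the inequality (`sq_deriv_le_of_ellipse`). Since `C` is irrelevant, an angular function may be
split into its even and odd parts under `x ↦ π - x`, each reducible to an algebraic polynomial in
`cos x` (`IsHalfAngle.hasChebyshevGrowth`). -/

namespace BallMesh

/-! ### Growth of bounded polynomials off the interval -/

open Polynomial in
/-- Bernstein's growth estimate: a polynomial of degree at most `N` bounded by `M` on `[-1, 1]` is
bounded by `M * exp (N * |Im z|)` at `cos z`. -/
theorem norm_aeval_cos_le (q : ℝ[X]) {N : ℕ} (hq : q.natDegree ≤ N) {M : ℝ}
    (hM : ∀ x : ℝ, |q.eval (Real.cos x)| ≤ M) (z : ℂ) :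
    ‖aeval (Complex.cos z) q‖ ≤ M * Real.exp (N * |z.im|) := by
  -- This is `ζ ^ N * q ((ζ + ζ⁻¹) / 2)` cleared of denominators, hence entire; the maximum
  -- principle on the unit disc applies to it.
  set h : ℂ → ℂ := fun ζ => ∑ j ∈ Finset.range (N + 1),
    (q.coeff j : ℂ) * (ζ ^ (N - j) * ((ζ ^ 2 + 1) / 2) ^ j) with hdef
  have key : ∀ y : ℂ, h (Complex.exp (y * Complex.I)) =
      Complex.exp (y * Complex.I) ^ N * aeval (Complex.cos y) q := by
    intro y
    have hne : Complex.exp (y * Complex.I) ≠ 0 := Complex.exp_ne_zero _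
    have hcos : (Complex.exp (y * Complex.I) ^ 2 + 1) / 2 =
        Complex.exp (y * Complex.I) * Complex.cos y := by
      rw [Complex.cos, neg_mul, Complex.exp_neg]
      field_simp
    rw [aeval_eq_sum_range' (Nat.lt_succ_of_le hq), Finset.mul_sum, hdef]
    refine Finset.sum_congr rfl fun j hj => ?_
    have hj' : j ≤ N := Nat.lt_succ_iff.mp (Finset.mem_range.mp hj)
    rw [hcos, mul_pow, ← mul_assoc (_ ^ (N - j)), ← pow_add, Nat.sub_add_cancel hj',
      Algebra.smul_def]
    simp only [Complex.coe_algebraMap]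
    ring
  have hdiff : Differentiable ℂ h := by
    rw [hdef]; fun_prop
  have hle : ∀ ζ : ℂ, ‖ζ‖ ≤ 1 → ‖h ζ‖ ≤ M := by
    intro ζ hζ
    refine Complex.norm_le_of_forall_mem_frontier_norm_le (U := Metric.ball 0 1)
      Metric.isBounded_ball hdiff.diffContOnCl (fun w hw => ?_) ?_
    · rw [frontier_ball _ one_ne_zero, mem_sphere_zero_iff_norm] at hw
      obtain ⟨x, rfl⟩ := (Complex.norm_eq_one_iff w).mp hw
      rw [key, norm_mul, norm_pow, Complex.norm_exp_ofReal_mul_I, one_pow, one_mul,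
        ← Complex.ofReal_cos]
      have : aeval (Real.cos x : ℂ) q = ((q.eval (Real.cos x) : ℝ) : ℂ) := by
        rw [← Complex.coe_algebraMap, aeval_algebraMap_apply, coe_aeval_eq_eval]
      rw [this, Complex.norm_real]
      exact hM x
    · rw [closure_ball _ one_ne_zero, mem_closedBall_zero_iff]
      exact hζ
  have main : ∀ y : ℂ, 0 ≤ y.im → ‖aeval (Complex.cos y) q‖ ≤ M * Real.exp (N * y.im) := by
    intro y hy
    have hn : ‖Complex.exp (y * Complex.I)‖ = Real.exp (-y.im) := by
      rw [Complex.norm_exp]; simp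
    have h1 := hle (Complex.exp (y * Complex.I)) (by rw [hn]; simpa using hy)
    rw [key, norm_mul, norm_pow, hn, ← Real.exp_nat_mul, mul_neg, Real.exp_neg] at h1
    rwa [inv_mul_le_iff₀ (Real.exp_pos _), mul_comm] at h1
  rcases le_total 0 z.im with hz | hz
  · rw [abs_of_nonneg hz]; exact main z hz
  · have := main (-z) (by simpa using hz)
    rwa [Complex.cos_neg, Complex.neg_im, ← abs_of_nonpos hz] at this

/-! ### From Chebyshev growth to an ellipse -/

theorem re_cos_eq (z : ℂ) : (Complex.cos z).re = Real.cos z.re * Real.cosh z.im := by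
  rw [Complex.cos_eq]
  simp [Complex.cos_ofReal_re, Complex.sin_ofReal_re, Complex.cosh_ofReal_re,
    Complex.sinh_ofReal_re]

theorem im_cos_eq (z : ℂ) : (Complex.cos z).im = -(Real.sin z.re * Real.sinh z.im) := by
  rw [Complex.cos_eq]
  simp [Complex.cos_ofReal_re, Complex.sin_ofReal_re, Complex.cosh_ofReal_re,
    Complex.sinh_ofReal_re]

/-- In fact `‖cos z‖ ^ 2 = cos (Re z) ^ 2 + sinh (Im z) ^ 2`. -/
theorem sinh_abs_le_norm_cos (z : ℂ) : Real.sinh |z.im| ≤ ‖Complex.cos z‖ := by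
  have h := Complex.sq_norm (Complex.cos z)
  rw [Complex.normSq_apply, re_cos_eq, im_cos_eq] at h
  refine abs_le_of_sq_le_sq' ?_ (norm_nonneg _) |>.2
  rw [h, ← Real.abs_sinh, sq_abs]
  have h1 := Real.cosh_sq z.im
  have h2 := Real.sin_sq_add_cos_sq z.re
  nlinarith [sq_nonneg (Real.cos z.re)]

/-- If `‖cos (k z)‖` grows at most like `exp (k B)`, then `|Im z| ≤ B`. -/
theorem abs_im_le_of_norm_cos_le {z : ℂ} {B C : ℝ} (hB : 0 ≤ B)
    (h : ∀ k : ℕ, ‖Complex.cos (k * z)‖ ≤ C * Real.exp (k * B)) : |z.im| ≤ B := by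
  by_contra! hlt
  have hb : 0 < |z.im| - B := by linarith
  -- A geometric sequence of ratio greater than one would stay bounded; this is where the factor `C`
  -- becomes harmless.
  have hbound : ∀ k : ℕ, Real.exp (|z.im| - B) ^ k ≤ 2 * C + 1 := by
    intro k
    have h1 := (sinh_abs_le_norm_cos (k * z)).trans (h k)
    have him : |((k : ℂ) * z).im| = k * |z.im| := by
      rw [← Complex.ofReal_natCast, Complex.im_ofReal_mul, abs_mul, Nat.abs_cast]
    rw [him, Real.sinh_eq] at h1
    have h2 : Real.exp (-(k * |z.im|)) ≤ 1 := Real.exp_le_one_iff.mpr (by simp; positivity)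
    have h3 : 1 ≤ Real.exp (k * B) := Real.one_le_exp (by positivity)
    rw [← Real.exp_nat_mul, mul_sub, Real.exp_sub, div_le_iff₀ (Real.exp_pos _)]
    linarith
  have ht := tendsto_pow_atTop_atTop_of_one_lt (Real.one_lt_exp_iff.mpr hb)
  obtain ⟨k, hk⟩ := (ht.eventually_gt_atTop (2 * C + 1)).exists
  exact absurd (hbound k) (not_le.mpr hk)

/-- A point whose Chebyshev values grow at most like `exp (k B)` lies in the ellipse with foci
`±1` and semi-axes `cosh B` and `sinh B`. -/
theorem mem_ellipse_of_norm_chebyshev_le {w : ℂ} {B C : ℝ} (hB : 0 ≤ B)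
    (h : ∀ k : ℕ, ‖(Polynomial.Chebyshev.T ℂ k).eval w‖ ≤ C * Real.exp (k * B)) :
    w.re ^ 2 * Real.sinh B ^ 2 + w.im ^ 2 * Real.cosh B ^ 2 ≤
      Real.sinh B ^ 2 * Real.cosh B ^ 2 := by
  obtain ⟨z, rfl⟩ := Complex.cos_surjective w
  have hz : |z.im| ≤ B := abs_im_le_of_norm_cos_le hB fun k => by
    simpa [Polynomial.Chebyshev.T_complex_cos] using h k
  rw [re_cos_eq, im_cos_eq]
  have h1 : Real.sinh z.im ^ 2 ≤ Real.sinh B ^ 2 := by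
    rw [← sq_abs, Real.abs_sinh]
    exact pow_le_pow_left₀ (Real.sinh_nonneg_iff.mpr (abs_nonneg _)) (Real.sinh_le_sinh.mpr hz) 2
  have h2 : Real.cosh z.im ^ 2 ≤ Real.cosh B ^ 2 := by
    rw [Real.cosh_sq, Real.cosh_sq]; linarith
  have h3 := Real.sin_sq_add_cos_sq z.re
  have h4 : Real.cosh z.im ^ 2 * Real.sinh B ^ 2 ≤ Real.sinh B ^ 2 * Real.cosh B ^ 2 := by
    rw [mul_comm]; gcongr
  have h5 : Real.sinh z.im ^ 2 * Real.cosh B ^ 2 ≤ Real.sinh B ^ 2 * Real.cosh B ^ 2 := by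
    gcongr
  calc _ = Real.cos z.re ^ 2 * (Real.cosh z.im ^ 2 * Real.sinh B ^ 2)
        + Real.sin z.re ^ 2 * (Real.sinh z.im ^ 2 * Real.cosh B ^ 2) := by ring
    _ ≤ Real.cos z.re ^ 2 * (Real.sinh B ^ 2 * Real.cosh B ^ 2)
        + Real.sin z.re ^ 2 * (Real.sinh B ^ 2 * Real.cosh B ^ 2) := by gcongr
    _ = _ := by rw [← add_mul, add_comm (Real.cos _ ^ 2), h3, one_mul]

/-! ### The Bernstein–Szegő inequality and its consequence near a maximum -/

/-- If `f` maps the line `Im z = t` into the ellipse with semi-axes `cosh (N t)` and `sinh (N t)`,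
then it satisfies a Bernstein–Szegő inequality at each real point of differentiability. -/
theorem sq_deriv_le_of_ellipse {f : ℂ → ℂ} {f' : ℂ} {x N : ℝ}
    (hf : HasDerivAt f f' x) (him : (f x).im = 0)
    (hell : ∀ t : ℝ, 0 < t → (f (x + t * Complex.I)).re ^ 2 * Real.sinh (N * t) ^ 2 +
      (f (x + t * Complex.I)).im ^ 2 * Real.cosh (N * t) ^ 2 ≤
      Real.sinh (N * t) ^ 2 * Real.cosh (N * t) ^ 2) :
    f'.re ^ 2 ≤ N ^ 2 * (1 - (f x).re ^ 2) := by
  have hline : HasDerivAt (fun t : ℂ => (x : ℂ) + t * Complex.I) Complex.I ((0 : ℝ) : ℂ) := by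
    simpa using ((hasDerivAt_id ((0 : ℝ) : ℂ)).mul_const Complex.I).const_add (x : ℂ)
  have hγ : HasDerivAt (fun t : ℝ => f (x + t * Complex.I)) (f' * Complex.I) 0 := by
    have := HasDerivAt.comp ((0 : ℝ) : ℂ) (h₂ := f) (h₂' := f') (by simpa using hf) hline
    exact this.comp_ofReal
  have h_im : HasDerivAt (fun t : ℝ => (f (x + t * Complex.I)).im) f'.re 0 := by
    have h : HasDerivAt (fun t : ℝ => (f (x + t * Complex.I)).im)
        (Complex.imCLM (f' * Complex.I)) 0 := Complex.imCLM.hasFDerivAt.comp_hasDerivAt (0 : ℝ) hγ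
    simpa using h
  have h_sinh : HasDerivAt (fun t : ℝ => Real.sinh (N * t)) N 0 := by
    have := ((hasDerivAt_id (0 : ℝ)).const_mul N).sinh
    simpa using this
  have t_im := h_im.tendsto_slope_zero_right
  have t_sinh := h_sinh.tendsto_slope_zero_right
  have t_re : Filter.Tendsto (fun t : ℝ => (f (x + t * Complex.I)).re) (nhdsWithin 0 (Set.Ioi 0))
      (nhds (f x).re) := by
    have h := (Complex.continuous_re.continuousAt.comp hγ.continuousAt).tendsto
    simp only [Function.comp_def, Complex.ofReal_zero, zero_mul, add_zero] at h
    exact h.mono_left nhdsWithin_le_nhds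
  have t_cosh : Filter.Tendsto (fun t : ℝ => Real.cosh (N * t)) (nhdsWithin 0 (Set.Ioi 0))
      (nhds 1) := by
    have h : Continuous fun t : ℝ => Real.cosh (N * t) := by fun_prop
    have := (h.tendsto 0).mono_left (nhdsWithin_le_nhds (s := Set.Ioi 0))
    simpa using this
  simp only [zero_add, smul_eq_mul, mul_zero, Real.sinh_zero, sub_zero, Complex.ofReal_zero,
    zero_mul, add_zero, him] at t_im t_sinh
  -- The ellipse inequality is divided by `t ^ 2` before `t → 0+`: `Im f / t` tends to `Re f'` and
  -- `sinh (N * t) / t` to `N`.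
  have hlim := le_of_tendsto_of_tendsto
    (((t_re.pow 2).mul (t_sinh.pow 2)).add ((t_im.pow 2).mul (t_cosh.pow 2)))
    ((t_sinh.pow 2).mul (t_cosh.pow 2)) (by
      filter_upwards [self_mem_nhdsWithin] with t ht
      have := mul_le_mul_of_nonneg_left (hell t ht) (sq_nonneg t⁻¹)
      linarith)
  linarith

/-- A function satisfying a Bernstein–Szegő inequality of order `N` stays above `M cos (N (x - y))`
near a point where it attains its bound `M`. -/
theorem mul_cos_le_of_deriv_sq_le {F F' : ℝ → ℝ} {M N : ℝ} (hN : 0 ≤ N) (hM : 0 < M)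
    (hF : ∀ x, HasDerivAt F (F' x) x)
    (hF' : ∀ M', M < M' → ∀ x, F' x ^ 2 ≤ N ^ 2 * (M' ^ 2 - F x ^ 2)) (hFM : ∀ x, |F x| ≤ M)
    {x y : ℝ} (hx : F x = M) (hxy : N * |y - x| ≤ Real.pi) :
    M * Real.cos (N * |y - x|) ≤ F y := by
  -- A bound `M' > M` keeps `F / M'` inside `(-1, 1)`, where `arcsin` is differentiable; continuity
  -- then allows `M' → M`.
  have step : ∀ M', M < M' →
      Real.arcsin (F x / M') - Real.arcsin (F y / M') ≤ N * |y - x| := by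
    intro M' hM'
    have hM'0 : 0 < M' := hM.trans hM'
    have hlt : ∀ s, |F s / M'| < 1 := fun s => by
      rw [abs_div, abs_of_pos hM'0, div_lt_one hM'0]; exact (hFM s).trans_lt hM'
    have hd : ∀ s, HasDerivAt (fun s => Real.arcsin (F s / M'))
        (1 / Real.sqrt (1 - (F s / M') ^ 2) * (F' s / M')) s := fun s => by
      have h1 := abs_lt.mp (hlt s)
      exact (Real.hasDerivAt_arcsin h1.1.ne' h1.2.ne).comp s ((hF s).div_const M')
    have hb : ∀ s, ‖1 / Real.sqrt (1 - (F s / M') ^ 2) * (F' s / M')‖ ≤ N := fun s => by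
      have hpos : 0 < 1 - (F s / M') ^ 2 := by
        have := (sq_lt_one_iff_abs_lt_one _).mpr (hlt s); linarith
      rw [Real.norm_eq_abs]
      refine abs_le_of_sq_le_sq ?_ hN
      rw [mul_pow, div_pow 1, Real.sq_sqrt hpos.le, one_pow, one_div, inv_mul_le_iff₀ hpos,
        div_pow, div_le_iff₀ (by positivity)]
      refine (hF' M' hM' s).trans_eq ?_
      field_simp
    have := Convex.norm_image_sub_le_of_norm_hasDerivWithin_le (s := Set.univ) (C := N)
      (fun s _ => (hd s).hasDerivWithinAt) (fun s _ => hb s) convex_univ (Set.mem_univ y)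
      (Set.mem_univ x)
    rw [Real.norm_eq_abs, Real.norm_eq_abs, abs_sub_comm x y] at this
    exact (le_abs_self _).trans this
  have hlim : Real.arcsin (F x / M) - Real.arcsin (F y / M) ≤ N * |y - x| := by
    have hc : ContinuousAt
        (fun M' : ℝ => Real.arcsin (F x / M') - Real.arcsin (F y / M')) M := by
      have h : ∀ c : ℝ, ContinuousAt (fun M' : ℝ => Real.arcsin (c / M')) M := fun c =>
        Real.continuous_arcsin.continuousAt.comp (continuousAt_const.div continuousAt_id hM.ne')
      exact (h _).sub (h _)
    refine le_of_tendsto (hc.tendsto.mono_left (nhdsWithin_le_nhds (s := Set.Ioi M))) ?_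
    filter_upwards [self_mem_nhdsWithin] with M' hM' using step M' hM'
  rw [hx, div_self hM.ne', Real.arcsin_one] at hlim
  have hy := abs_le.mp (hFM y)
  have h1 : Real.sin (Real.pi / 2 - N * |y - x|) ≤ Real.sin (Real.arcsin (F y / M)) := by
    refine Real.sin_le_sin_of_le_of_le_pi_div_two ?_ (Real.arcsin_le_pi_div_two _) (by linarith)
    linarith
  rw [Real.sin_pi_div_two_sub, Real.sin_arcsin (by rw [le_div_iff₀ hM]; linarith)
    (by rw [div_le_one hM]; exact hy.2), le_div_iff₀ hM] at h1
  linarith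

/-! ### Functions with Chebyshev growth -/

/-- `F` extends holomorphically across the real line, and, once it is normalised to be bounded by
one, the Chebyshev polynomials of the extension grow at most like `exp (k * N * |Im z|)`. -/
def HasChebyshevGrowth (N : ℝ) (F : ℝ → ℝ) : Prop :=
  ∃ f : ℂ → ℂ, (∀ x : ℝ, f x = F x) ∧ (∀ x : ℝ, DifferentiableAt ℂ f x) ∧
    ∀ M : ℝ, 0 < M → (∀ x, |F x| ≤ M) → ∀ z : ℂ, ∃ C : ℝ, ∀ k : ℕ,
      ‖(Polynomial.Chebyshev.T ℂ k).eval ((M : ℂ)⁻¹ * f z)‖ ≤ C * Real.exp (k * (N * |z.im|))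

theorem HasChebyshevGrowth.continuous {F : ℝ → ℝ} {N : ℝ} (h : HasChebyshevGrowth N F) :
    Continuous F := by
  obtain ⟨f, hf, hd, -⟩ := h
  refine continuous_iff_continuousAt.mpr fun x => ?_
  have h1 := (hd x).hasDerivAt.real_of_complex.continuousAt
  simpa [hf] using h1

/-- The growth at `s + t * I` gives the ellipse with parameter `N * t`, hence the Bernstein–Szegő
inequality for each `M' > M`. If `F x = -M`, the argument runs on `-F`. -/
theorem HasChebyshevGrowth.mul_cos_le {F : ℝ → ℝ} {M N : ℝ} (h : HasChebyshevGrowth N F)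
    (hN : 0 ≤ N) (hM : 0 < M) (hFM : ∀ x, |F x| ≤ M) {x y : ℝ} (hx : |F x| = M)
    (hxy : N * |y - x| ≤ Real.pi) : M * Real.cos (N * |y - x|) ≤ |F y| := by
  obtain ⟨f, hf, hd, hg⟩ := h
  have hF : ∀ s : ℝ, HasDerivAt F (deriv f s).re s := fun s => by
    have := (hd s).hasDerivAt.real_of_complex
    simpa [hf] using this
  have hF' : ∀ M', M < M' → ∀ s : ℝ, (deriv f s).re ^ 2 ≤ N ^ 2 * (M' ^ 2 - F s ^ 2) := by
    intro M' hM' s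
    have hM'0 : 0 < M' := hM.trans hM'
    have h1 := sq_deriv_le_of_ellipse (f := fun z => (M' : ℂ)⁻¹ * f z) (x := s) (N := N)
      ((hd s).hasDerivAt.const_mul _) (by rw [hf, ← Complex.ofReal_inv, ← Complex.ofReal_mul,
        Complex.ofReal_im]) (fun t ht => by
        obtain ⟨C, hC⟩ := hg M' hM'0 (fun s => (hFM s).trans hM'.le) (s + t * Complex.I)
        refine mem_ellipse_of_norm_chebyshev_le (C := C) (by positivity) fun k => ?_
        simpa [abs_of_pos ht] using hC k)
    rw [hf, ← Complex.ofReal_inv, Complex.re_ofReal_mul, ← Complex.ofReal_mul, Complex.ofReal_re,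
      mul_pow, mul_pow, inv_pow, inv_mul_le_iff₀ (by positivity)] at h1
    refine h1.trans_eq ?_
    field_simp
  rcases eq_or_eq_neg_of_abs_eq hx with hx | hx
  · exact (mul_cos_le_of_deriv_sq_le hN hM hF hF' hFM hx hxy).trans (le_abs_self _)
  · refine (mul_cos_le_of_deriv_sq_le (F := fun s => -F s) hN hM (fun s => (hF s).neg)
      (fun M' hM' s => ?_) (fun s => by rw [abs_neg]; exact hFM s) (by rw [hx, neg_neg])
      hxy).trans (neg_le_abs _)
    rw [neg_sq, neg_sq]
    exact hF' M' hM' s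

/-- A function with Chebyshev growth is controlled on `[0, π]` by its values at angles that come
within `π / (2 m N)` of every point of `[0, π]`. -/
theorem HasChebyshevGrowth.exists_node {F : ℝ → ℝ} {N : ℝ} (h : HasChebyshevGrowth N F)
    (hN : 0 ≤ N) (hred : ∀ x, ∃ y ∈ Set.Icc 0 Real.pi, F y = F x) {m : ℕ} (hm : 1 < m)
    {S : Set ℝ} (hS : ∀ x ∈ Set.Icc 0 Real.pi, ∃ s ∈ S, N * |s - x| ≤ Real.pi / (2 * m))
    {x : ℝ} (hx : x ∈ Set.Icc 0 Real.pi) : ∃ s ∈ S, |F x| ≤ meshConst m * |F s| := by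
  have hm' : (1 : ℝ) < m := by exact_mod_cast hm
  have hlt : Real.pi / (2 * m) < Real.pi / 2 :=
    div_lt_div_of_pos_left Real.pi_pos (by norm_num) (by linarith)
  have hcos : 0 < Real.cos (Real.pi / (2 * m)) :=
    Real.cos_pos_of_mem_Ioo ⟨by have : 0 < Real.pi / (2 * m) := by positivity
                                linarith [Real.pi_pos], hlt⟩
  -- The node is sought near the maximum point `x₀`, not near `x`; by `hred` the maximum over `[0,
  -- π]` is global.
  obtain ⟨x₀, hx₀, hmax⟩ := isCompact_Icc.exists_isMaxOn (Set.nonempty_of_mem hx)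
    h.continuous.abs.continuousOn
  obtain ⟨s, hs, hsx⟩ := hS x₀ hx₀
  refine ⟨s, hs, (hmax hx).trans ?_⟩
  rw [meshConst, one_div, inv_mul_eq_div, le_div_iff₀ hcos]
  rcases (abs_nonneg (F x₀)).eq_or_lt with h0 | h0
  · simp [← h0]
  · refine le_trans ?_ (h.mul_cos_le hN h0 (fun t => ?_) rfl (hsx.trans (by linarith [Real.pi_pos])))
    · refine mul_le_mul_of_nonneg_left ?_ h0.le
      exact Real.cos_le_cos_of_nonneg_of_le_pi (by positivity) (by linarith [Real.pi_pos]) hsx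
    · obtain ⟨y, hy, hyt⟩ := hred t
      rw [← hyt]
      exact hmax hy

-- `T_k (q / M)` is a polynomial of degree at most `k * n` bounded by one on `[-1, 1]`, so
-- `norm_aeval_cos_le` applies with `C = 1`.
open Polynomial in
theorem hasChebyshevGrowth_eval_cos (q : ℝ[X]) {n : ℕ} (hq : q.natDegree ≤ n) :
    HasChebyshevGrowth n (fun x => q.eval (Real.cos x)) := by
  refine ⟨fun z => aeval (Complex.cos z) q, fun x => ?_, fun x => ?_, fun M hM hb z =>
    ⟨1, fun k => ?_⟩⟩
  · beta_reduce
    rw [← Complex.ofReal_cos, ← Complex.coe_algebraMap, aeval_algebraMap_apply, coe_aeval_eq_eval]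
  · exact (q.differentiable_aeval.comp Complex.differentiable_cos).differentiableAt
  · set r : ℝ[X] := (Chebyshev.T ℝ k).comp (C M⁻¹ * q)
    have hr : r.natDegree ≤ k * n := by
      refine natDegree_comp_le.trans ?_
      rw [Chebyshev.natDegree_T]
      exact Nat.mul_le_mul (by simp) ((natDegree_C_mul_le _ _).trans hq)
    have h1 := norm_aeval_cos_le r hr (M := 1) (fun x => ?_) z
    · rw [aeval_comp, Chebyshev.aeval_T] at h1
      simp only [map_mul, aeval_C, Complex.coe_algebraMap, Complex.ofReal_inv] at h1
      refine h1.trans_eq ?_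
      push_cast
      ring_nf
    · rw [eval_comp, eval_mul, eval_C]
      refine Chebyshev.abs_eval_T_real_le_one _ ?_
      rw [abs_mul, abs_inv, abs_of_pos hM, inv_mul_le_iff₀ hM, mul_one]
      exact hb x

/-! ### Trigonometric polynomials in half angles -/

open Polynomial in
/-- On the curve `v ^ 2 + w ^ 2 = 1`, with `v = sin (s / 2)` and `w = cos (s / 2)`, the function `g`
is a trigonometric polynomial in `s` of degree at most `n`, written in terms of half angles. -/
def IsHalfAngle (n : ℕ) (g : ℂ → ℂ → ℂ) : Prop :=
  ∃ P Q : ℝ[X], P.natDegree ≤ n ∧ (X * Q).natDegree ≤ n ∧ ∀ v w : ℂ, v ^ 2 + w ^ 2 = 1 →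
    g v w = aeval (v ^ 2) P + v * w * aeval (v ^ 2) Q

-- A bound on the degree of `X * Q` encodes `deg Q ≤ n - 1` without truncated subtraction, forcing
-- `Q = 0` when `n = 0`. The degree thus saved in `R` pays for the factor `1 - X`.
open Polynomial in
theorem natDegree_one_sub_X_mul_le {Q R : ℝ[X]} {m n : ℕ} (hQ : (X * Q).natDegree ≤ m)
    (hR : (X * R).natDegree ≤ n) : ((1 - X) * (X * Q) * R).natDegree ≤ m + n := by
  rcases eq_or_ne R 0 with rfl | h
  · simp
  · rw [natDegree_X_mul h] at hR
    have h1 : ((1 : ℝ[X]) - X).natDegree ≤ 1 := by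
      refine (natDegree_sub_le _ _).trans ?_
      simp
    have h2 := natDegree_mul_le (p := (1 - X) * (X * Q)) (q := R)
    have h3 := natDegree_mul_le (p := (1 : ℝ[X]) - X) (q := X * Q)
    omega

namespace IsHalfAngle

theorem mono {m n : ℕ} {g : ℂ → ℂ → ℂ} (h : IsHalfAngle m g) (hmn : m ≤ n) :
    IsHalfAngle n g := by
  obtain ⟨P, Q, hP, hQ, hg⟩ := h
  exact ⟨P, Q, hP.trans hmn, hQ.trans hmn, hg⟩

open Polynomial in
theorem const (c : ℝ) : IsHalfAngle 0 fun _ _ => (c : ℂ) :=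
  ⟨C c, 0, by simp, by simp, fun v w _ => by simp⟩

-- With `v = sin (s / 2)` and `w = cos (s / 2)` this is `a + b * cos s + c * sin s`.
open Polynomial in
theorem affine (a b c : ℝ) :
    IsHalfAngle 1 fun v w => a + b * (1 - 2 * v ^ 2) + c * (2 * v * w) :=
  ⟨C (a + b) + C (-2 * b) * X, C (2 * c), natDegree_add_le_of_degree_le (by simp)
    (natDegree_C_mul_le _ _ |>.trans natDegree_X_le),
    by rw [mul_comm]; exact natDegree_C_mul_le _ _ |>.trans natDegree_X_le, fun v w _ => by
      simp only [map_add, map_mul, aeval_C, aeval_X, Complex.coe_algebraMap]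
      push_cast
      ring⟩

open Polynomial in
theorem add {n : ℕ} {g h : ℂ → ℂ → ℂ} (hg : IsHalfAngle n g) (hh : IsHalfAngle n h) :
    IsHalfAngle n fun v w => g v w + h v w := by
  obtain ⟨P, Q, hP, hQ, hg⟩ := hg
  obtain ⟨P', Q', hP', hQ', hh⟩ := hh
  refine ⟨P + P', Q + Q', natDegree_add_le_of_degree_le hP hP', ?_, fun v w hvw => ?_⟩
  · rw [mul_add]; exact natDegree_add_le_of_degree_le hQ hQ'
  · simp only [hg v w hvw, hh v w hvw, map_add]; ring

open Polynomial in
theorem mul {m n : ℕ} {g h : ℂ → ℂ → ℂ} (hg : IsHalfAngle m g) (hh : IsHalfAngle n h) :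
    IsHalfAngle (m + n) fun v w => g v w * h v w := by
  obtain ⟨P, Q, hP, hQ, hg⟩ := hg
  obtain ⟨P', Q', hP', hQ', hh⟩ := hh
  -- The product of the two odd parts is even, since `(v * w) ^ 2 = v ^ 2 * (1 - v ^ 2)` on the
  -- curve.
  refine ⟨P * P' + (1 - X) * (X * Q) * Q', P * Q' + Q * P',
    natDegree_add_le_of_degree_le (natDegree_mul_le.trans (add_le_add hP hP'))
      (natDegree_one_sub_X_mul_le hQ hQ'), ?_, fun v w hvw => ?_⟩
  · rw [show X * (P * Q' + Q * P') = P * (X * Q') + X * Q * P' by ring]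
    exact natDegree_add_le_of_degree_le (natDegree_mul_le.trans (add_le_add hP hQ'))
      (natDegree_mul_le.trans (add_le_add hQ hP'))
  · simp only [hg v w hvw, hh v w hvw, map_add, map_mul, map_sub, map_one, aeval_X]
    linear_combination v ^ 2 * aeval (v ^ 2) Q * aeval (v ^ 2) Q' * hvw

theorem pow {n : ℕ} {g : ℂ → ℂ → ℂ} (hg : IsHalfAngle n g) (k : ℕ) :
    IsHalfAngle (k * n) fun v w => g v w ^ k := by
  induction k with
  | zero => simpa using const 1
  | succ k ih => simpa only [pow_succ, add_mul, one_mul] using ih.mul hg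

theorem sum {ι : Type*} {n : ℕ} (s : Finset ι) {g : ι → ℂ → ℂ → ℂ}
    (hg : ∀ i ∈ s, IsHalfAngle n (g i)) : IsHalfAngle n fun v w => ∑ i ∈ s, g i v w := by
  classical
  induction s using Finset.induction_on with
  | empty => simpa using (const 0).mono (Nat.zero_le n)
  | insert a s ha ih =>
    simp only [Finset.sum_insert ha]
    exact (hg a (Finset.mem_insert_self a s)).add
      (ih fun i hi => hg i (Finset.mem_insert_of_mem hi))

theorem prod {ι : Type*} {n : ι → ℕ} (s : Finset ι) {g : ι → ℂ → ℂ → ℂ}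
    (hg : ∀ i ∈ s, IsHalfAngle (n i) (g i)) :
    IsHalfAngle (∑ i ∈ s, n i) fun v w => ∏ i ∈ s, g i v w := by
  classical
  induction s using Finset.induction_on with
  | empty => simpa using const 1
  | insert a s ha ih =>
    simp only [Finset.prod_insert ha, Finset.sum_insert ha]
    exact (hg a (Finset.mem_insert_self a s)).mul
      (ih fun i hi => hg i (Finset.mem_insert_of_mem hi))

open Polynomial in
theorem polynomial_aeval {k n : ℕ} {g : ℂ → ℂ → ℂ} (hg : IsHalfAngle n g) (r : ℝ[X])
    (hr : r.natDegree ≤ k) : IsHalfAngle (k * n) fun v w => aeval (g v w) r := by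
  simp only [aeval_eq_sum_range, Algebra.smul_def, Complex.coe_algebraMap]
  refine sum _ fun j hj => ((const _).mul (hg.pow j)).mono ?_
  rw [zero_add]
  exact Nat.mul_le_mul_right _ ((Nat.lt_succ_iff.mp (Finset.mem_range.mp hj)).trans hr)

theorem mvPolynomial_aeval {ι : Type*} {n : ℕ} {g : ι → ℂ → ℂ → ℂ}
    (hg : ∀ i, IsHalfAngle 1 (g i)) (p : MvPolynomial ι ℝ) (hp : p.totalDegree ≤ n) :
    IsHalfAngle n fun v w => MvPolynomial.aeval (fun i => g i v w) p := by
  simp only [MvPolynomial.aeval_def, MvPolynomial.eval₂_eq, Complex.coe_algebraMap]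
  refine sum _ fun e he => ((const _).mul (prod _ fun i _ => (hg i).pow (e i))).mono ?_
  simp only [mul_one, zero_add]
  exact (MvPolynomial.le_totalDegree he).trans hp

open Polynomial in
/-- A trigonometric polynomial on an arc, parametrised by `sin (s / 2) = α * cos x`. -/
theorem hasChebyshevGrowth {n : ℕ} {g : ℂ → ℂ → ℂ} (hg : IsHalfAngle n g) {α : ℝ}
    {W : ℂ → ℂ} {w : ℝ → ℝ} (hW : ∀ z, (α * Complex.cos z) ^ 2 + W z ^ 2 = 1)
    (hWd : ∀ x : ℝ, DifferentiableAt ℂ W x) (hWw : ∀ x : ℝ, W x = w x)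
    (hw : ∀ x, w (Real.pi - x) = w x) {F : ℝ → ℝ}
    (hF : ∀ x : ℝ, (F x : ℂ) = g (α * Real.cos x : ℝ) (w x)) :
    HasChebyshevGrowth (2 * n) F := by
  have hww : ∀ x : ℝ, (α * Real.cos x) ^ 2 + w x ^ 2 = 1 := fun x => by
    have := hW x
    rw [hWw] at this
    exact_mod_cast this
  refine ⟨fun z => g (α * Complex.cos z) (W z), fun x => ?_, fun x => ?_, fun M hM hb z =>
    ⟨2, fun k => ?_⟩⟩
  · beta_reduce
    rw [hF, hWw]; push_cast; rfl
  · obtain ⟨P, Q, -, -, h⟩ := hg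
    simp only [h _ _ (hW _)]
    have h1 : DifferentiableAt ℂ (fun z : ℂ => (α * Complex.cos z) ^ 2) x := by fun_prop
    have h2 : ∀ R : ℝ[X], DifferentiableAt ℂ (fun z => aeval ((α * Complex.cos z) ^ 2) R) x :=
      fun R => DifferentiableAt.comp (g := fun y => aeval y R) (x : ℂ)
        R.differentiable_aeval.differentiableAt h1
    have := hWd x
    have := h2 P
    have := h2 Q
    fun_prop
  · obtain ⟨P, Q, hP, hQ, h⟩ := ((const M⁻¹).mul hg).polynomial_aeval (k := k) (Chebyshev.T ℝ k)
      (by rw [Chebyshev.natDegree_T]; simp)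
    rw [zero_add] at hP hQ
    beta_reduce at h
    have hreal : ∀ x : ℝ, |P.eval ((α * Real.cos x) ^ 2) +
        α * Real.cos x * w x * Q.eval ((α * Real.cos x) ^ 2)| ≤ 1 := by
      intro x
      have h1 := h (α * Real.cos x : ℝ) (w x) (by exact_mod_cast hww x)
      rw [← hF, ← Complex.ofReal_mul, ← Complex.ofReal_pow, ← Complex.coe_algebraMap,
        aeval_algebraMap_apply, aeval_algebraMap_apply, aeval_algebraMap_apply] at h1
      simp only [coe_aeval_eq_eval, Complex.coe_algebraMap] at h1
      norm_cast at h1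
      rw [← h1]
      refine Chebyshev.abs_eval_T_real_le_one _ ?_
      rw [abs_mul, abs_inv, abs_of_pos hM, inv_mul_le_iff₀ hM, mul_one]
      exact hb x
    -- Replacing `x` by `π - x` changes the sign of `cos x` but not of `w`, so the even and odd
    -- parts are each bounded by one.
    have hrefl : ∀ x : ℝ, |P.eval ((α * Real.cos x) ^ 2) -
        α * Real.cos x * w x * Q.eval ((α * Real.cos x) ^ 2)| ≤ 1 := by
      intro x
      have := hreal (Real.pi - x)
      rw [Real.cos_pi_sub, hw] at this
      simpa [sub_eq_add_neg] using this
    have hα : (C (α ^ 2) * X ^ 2 : ℝ[X]).natDegree ≤ 2 := natDegree_C_mul_X_pow_le _ _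
    have hPz := norm_aeval_cos_le (P.comp (C (α ^ 2) * X ^ 2)) (M := 1) (N := k * n * 2)
      (natDegree_comp_le.trans (Nat.mul_le_mul hP hα)) (fun x => by
        have h1 := abs_le.mp (hreal x)
        have h2 := abs_le.mp (hrefl x)
        rw [eval_comp, eval_mul, eval_C, eval_pow, eval_X, ← mul_pow]
        exact abs_le.mpr ⟨by linarith, by linarith⟩) z
    -- The odd part contains `w`, but its square is a polynomial in `cos x` of twice the degree; a
    -- square root at the end restores the right exponent. The sum of the two parts accounts for the
    -- constant `2`.
    have hQz := norm_aeval_cos_le (((1 - X) * (X * Q) * Q).comp (C (α ^ 2) * X ^ 2)) (M := 1)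
      (N := (k * n + k * n) * 2) (natDegree_comp_le.trans
        (Nat.mul_le_mul (natDegree_one_sub_X_mul_le hQ hQ) hα)) (fun x => by
        have h1 := abs_le.mp (hreal x)
        have h2 := abs_le.mp (hrefl x)
        rw [eval_comp, eval_mul (q := X ^ 2), eval_C, eval_pow, eval_X, ← mul_pow]
        simp only [eval_mul, eval_sub, eval_one, eval_X]
        have h3 : (1 - (α * Real.cos x) ^ 2) * ((α * Real.cos x) ^ 2 *
            eval ((α * Real.cos x) ^ 2) Q) * eval ((α * Real.cos x) ^ 2) Q =
            (α * Real.cos x * w x * Q.eval ((α * Real.cos x) ^ 2)) ^ 2 := by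
          rw [← hww x]; ring
        rw [h3, abs_of_nonneg (sq_nonneg _), sq_le_one_iff_abs_le_one]
        exact abs_le.mpr ⟨by linarith, by linarith⟩) z
    have h1 := h (α * Complex.cos z) (W z) (hW z)
    rw [Chebyshev.aeval_T, Complex.ofReal_inv] at h1
    beta_reduce
    rw [h1]
    simp only [aeval_comp, map_mul, map_sub, map_one, map_pow, aeval_C, aeval_X,
      Complex.coe_algebraMap, one_mul] at hPz hQz
    rw [← mul_pow] at hPz hQz
    have h3 : (1 - (α * Complex.cos z) ^ 2) * ((α * Complex.cos z) ^ 2 *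
        aeval ((α * Complex.cos z) ^ 2) Q) * aeval ((α * Complex.cos z) ^ 2) Q =
        (α * Complex.cos z * W z * aeval ((α * Complex.cos z) ^ 2) Q) ^ 2 := by
      rw [← hW z]; ring
    rw [h3, norm_pow] at hQz
    have h4 : Real.exp (((k * n + k * n) * 2 : ℕ) * |z.im|) =
        Real.exp (k * (2 * n * |z.im|)) ^ 2 := by
      rw [← Real.exp_nat_mul]; push_cast; ring_nf
    have h5 : Real.exp ((k * n * 2 : ℕ) * |z.im|) = Real.exp (k * (2 * n * |z.im|)) := by
      push_cast; ring_nf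
    rw [h4] at hQz
    rw [h5] at hPz
    have h6 := abs_le_of_sq_le_sq' hQz (Real.exp_pos _).le
    refine (norm_add_le _ _).trans ?_
    linarith [h6.2]

/-- A trigonometric polynomial in an angle from an arc shorter than the circle. -/
theorem hasChebyshevGrowth_arc {n : ℕ} {g : ℂ → ℂ → ℂ} (hg : IsHalfAngle n g) {α : ℝ}
    (hα : |α| < 1) {F : ℝ → ℝ}
    (hF : ∀ x : ℝ, (F x : ℂ) = g (α * Real.cos x : ℝ) (Real.sqrt (1 - (α * Real.cos x) ^ 2))) :
    HasChebyshevGrowth (2 * n) F := by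
  have hpos : ∀ x : ℝ, 0 < 1 - (α * Real.cos x) ^ 2 := fun x => by
    have : |α * Real.cos x| < 1 := by
      rw [abs_mul]
      exact (mul_le_of_le_one_right (abs_nonneg _) (Real.abs_cos_le_one x)).trans_lt hα
    have := (sq_lt_one_iff_abs_lt_one _).mpr this
    linarith
  -- The principal square root need only be differentiable at real points, where `|α| < 1` keeps its
  -- argument positive; elsewhere only `W ^ 2` matters.
  refine hg.hasChebyshevGrowth (W := fun z => (1 - (α * Complex.cos z) ^ 2) ^ (1 / 2 : ℂ))
    (w := fun x => Real.sqrt (1 - (α * Real.cos x) ^ 2)) (fun z => ?_) (fun x => ?_)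
    (fun x => ?_) (fun x => ?_) hF
  · rw [← Complex.cpow_nat_mul]; norm_num
  · have h1 : DifferentiableAt ℂ (fun z : ℂ => 1 - (α * Complex.cos z) ^ 2) x := by fun_prop
    refine h1.cpow_const (Or.inl ?_)
    have := hpos x
    rw [← Complex.ofReal_cos]
    exact_mod_cast this
  · rw [Real.sqrt_eq_rpow, Complex.ofReal_cpow (hpos x).le]
    push_cast
    rfl
  · rw [Real.cos_pi_sub]; simp

/-- A trigonometric polynomial in an angle from the full circle. -/
theorem hasChebyshevGrowth_circle {n : ℕ} {g : ℂ → ℂ → ℂ} (hg : IsHalfAngle n g)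
    {F : ℝ → ℝ} (hF : ∀ x : ℝ, (F x : ℂ) = g (Real.cos x) (Real.sin x)) :
    HasChebyshevGrowth (2 * n) F := by
  -- For `α = 1` the square root would be `|sin x|`, which is not smooth; `sin` replaces it.
  refine hg.hasChebyshevGrowth (α := 1) (W := Complex.sin) (w := Real.sin) (fun z => ?_)
    (fun x => Complex.differentiableAt_sin) (fun x => (Complex.ofReal_sin x).symm)
    Real.sin_pi_sub (fun x => by rw [hF, one_mul])
  rw [Complex.ofReal_one, one_mul]
  exact Complex.cos_sq_add_sin_sq z

end IsHalfAngle

/-! ### Density of the nodes and one-variable norming estimates -/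

theorem exists_chebyshevPoints_near {K : ℕ} (hK : 1 ≤ K) {x : ℝ} (hx : x ∈ Set.Icc 0 Real.pi) :
    ∃ s ∈ Set.Icc 0 Real.pi, Real.cos s ∈ chebyshevPoints K ∧ |s - x| ≤ Real.pi / (2 * K) := by
  have hK0 : (0 : ℝ) < K := by exact_mod_cast hK
  have hpi := Real.pi_pos
  set y : ℝ := x * K / Real.pi with hy
  have hxy : x = y * Real.pi / K := by rw [hy]; field_simp
  have hy0 : 0 ≤ y := by have := hx.1; positivity
  have hyK : y ≤ K := by
    rw [hy, div_le_iff₀ hpi, mul_comm]; exact mul_le_mul_of_nonneg_left hx.2 hK0.le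
  -- The angles are midpoints of `K` equal intervals and `j` numbers the one containing `x`; at `y =
  -- K` the floor would overshoot.
  obtain ⟨j, hj1, hjK, hjl, hju⟩ : ∃ j : ℕ, 1 ≤ j ∧ j ≤ K ∧ (j : ℝ) - 1 ≤ y ∧ y ≤ j := by
    rcases eq_or_lt_of_le hyK with h | h
    · exact ⟨K, hK, le_rfl, by linarith, hyK⟩
    · exact ⟨⌊y⌋₊ + 1, by omega, Nat.succ_le_of_lt ((Nat.floor_lt hy0).mpr h),
        by push_cast; linarith [Nat.floor_le hy0], by push_cast; exact (Nat.lt_floor_add_one y).le⟩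
  have hj1' : (1 : ℝ) ≤ j := by exact_mod_cast hj1
  have hjK' : (j : ℝ) ≤ K := by exact_mod_cast hjK
  refine ⟨(2 * (j : ℝ) - 1) * Real.pi / (2 * K), ⟨?_, ?_⟩, ⟨j, hj1, hjK, rfl⟩, ?_⟩
  · exact div_nonneg (mul_nonneg (by linarith) hpi.le) (by positivity)
  · rw [div_le_iff₀ (by positivity), mul_comm]
    exact mul_le_mul_of_nonneg_left (by linarith) hpi.le
  · have : (2 * (j : ℝ) - 1) * Real.pi / (2 * K) - x = (2 * (j - y) - 1) * (Real.pi / (2 * K)) := by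
      rw [hxy]; field_simp; ring
    rw [this, abs_mul, abs_of_nonneg (show 0 ≤ Real.pi / (2 * K) by positivity)]
    refine mul_le_of_le_one_left (by positivity) (abs_le.mpr ⟨by linarith, by linarith⟩)

theorem exists_chebyshevLobattoPoints_near {K : ℕ} (hK : 1 ≤ K) {x : ℝ}
    (hx : x ∈ Set.Icc 0 Real.pi) : ∃ s ∈ Set.Icc 0 Real.pi,
      Real.cos s ∈ chebyshevLobattoPoints K ∧ |s - x| ≤ Real.pi / (2 * K) := by
  have hK0 : (0 : ℝ) < K := by exact_mod_cast hK
  have hpi := Real.pi_pos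
  set y : ℝ := x * K / Real.pi with hy
  have hxy : x = y * Real.pi / K := by rw [hy]; field_simp
  have hy0 : 0 ≤ y := by have := hx.1; positivity
  have hyK : y ≤ K := by
    rw [hy, div_le_iff₀ hpi, mul_comm]; exact mul_le_mul_of_nonneg_left hx.2 hK0.le
  have hjl : (⌊y + 1 / 2⌋₊ : ℝ) ≤ y + 1 / 2 := Nat.floor_le (by linarith)
  have hju : y + 1 / 2 < ⌊y + 1 / 2⌋₊ + 1 := Nat.lt_floor_add_one _
  have hjK : ⌊y + 1 / 2⌋₊ ≤ K :=
    Nat.lt_succ_iff.mp ((Nat.floor_lt (by linarith)).mpr (by push_cast; linarith))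
  have hjK' : (⌊y + 1 / 2⌋₊ : ℝ) ≤ K := by exact_mod_cast hjK
  refine ⟨(⌊y + 1 / 2⌋₊ : ℝ) * Real.pi / K, ⟨by positivity, ?_⟩, ⟨_, hjK, rfl⟩, ?_⟩
  · rw [div_le_iff₀ (by positivity), mul_comm]
    exact mul_le_mul_of_nonneg_left hjK' hpi.le
  · have : (⌊y + 1 / 2⌋₊ : ℝ) * Real.pi / K - x =
        (2 * (⌊y + 1 / 2⌋₊ - y)) * (Real.pi / (2 * K)) := by
      rw [hxy]; field_simp
    rw [this, abs_mul, abs_of_nonneg (show 0 ≤ Real.pi / (2 * K) by positivity)]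
    refine mul_le_of_le_one_left (by positivity) (abs_le.mpr ⟨by linarith, by linarith⟩)

/-- Agreement of `F` with `f ∘ cos` is asked only on `[0, π]`: on the circle `F` involves `sin x`,
whereas `f` involves the square root `|sin x|`. -/
theorem HasChebyshevGrowth.exists_chebyshev_node {F : ℝ → ℝ} {N : ℝ}
    (h : HasChebyshevGrowth N F) (hN : 0 ≤ N) (hred : ∀ x, ∃ y ∈ Set.Icc 0 Real.pi, F y = F x)
    {m : ℕ} (hm : 1 < m) {C : ℕ → Set ℝ} (hC : C = chebyshevPoints ∨ C = chebyshevLobattoPoints)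
    {K : ℕ} (hK : 1 ≤ K) (hNK : N * m = K) {f : ℝ → ℝ}
    (hf : ∀ x ∈ Set.Icc 0 Real.pi, F x = f (Real.cos x)) {y : ℝ} (hy : y ∈ Set.Icc (-1) 1) :
    ∃ v ∈ C K, |f y| ≤ meshConst m * |f v| := by
  have hK0 : (0 : ℝ) < K := by exact_mod_cast hK
  have hm0 : (0 : ℝ) < m := by exact_mod_cast (zero_lt_one.trans hm)
  have hmem : Real.arccos y ∈ Set.Icc 0 Real.pi := ⟨Real.arccos_nonneg y, Real.arccos_le_pi y⟩
  have hnear : ∀ x ∈ Set.Icc 0 Real.pi,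
      ∃ s ∈ Set.Icc 0 Real.pi, Real.cos s ∈ C K ∧ |s - x| ≤ Real.pi / (2 * K) := by
    rcases hC with rfl | rfl
    · exact fun x hx => exists_chebyshevPoints_near hK hx
    · exact fun x hx => exists_chebyshevLobattoPoints_near hK hx
  obtain ⟨s, ⟨hs, hsC⟩, hle⟩ := h.exists_node hN hred hm
    (S := {s | s ∈ Set.Icc 0 Real.pi ∧ Real.cos s ∈ C K}) (fun x hx => by
      obtain ⟨s, hs, hsC, hsx⟩ := hnear x hx
      refine ⟨s, ⟨hs, hsC⟩, (mul_le_mul_of_nonneg_left hsx hN).trans_eq ?_⟩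
      rw [← hNK] at hK0 ⊢
      have hN' : N ≠ 0 := by rintro rfl; simp at hK0
      field_simp) hmem
  rw [hf _ hmem, hf s hs, Real.cos_arccos hy.1 hy.2] at hle
  exact ⟨_, hsC, hle⟩

theorem ofReal_eval {ι : Type*} (p : MvPolynomial ι ℝ) (x : ι → ℝ) :
    ((MvPolynomial.eval x p : ℝ) : ℂ) = MvPolynomial.aeval (fun i => (x i : ℂ)) p :=
  (MvPolynomial.aeval_algebraMap_apply ℂ x p).symm

/-- A polynomial restricted to an ellipse arc, in half-angle form. -/
theorem exists_chebyshev_node_arc {ι : Type*} {p : MvPolynomial ι ℝ} {n : ℕ} (hn : 1 ≤ n)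
    (hp : p.totalDegree ≤ n) (a b c : ι → ℝ) {m : ℕ} (hm : 1 < m) {C : ℕ → Set ℝ}
    (hC : C = chebyshevPoints ∨ C = chebyshevLobattoPoints) {α : ℝ} (hα : |α| < 1 ∨ α = 1)
    {f : ℝ → ℝ} (hf : ∀ y ∈ Set.Icc (-1 : ℝ) 1, f y = MvPolynomial.eval (fun i =>
      a i + b i * (1 - 2 * (α * y) ^ 2) + c i * (2 * (α * y) * Real.sqrt (1 - (α * y) ^ 2))) p)
    {y : ℝ} (hy : y ∈ Set.Icc (-1) 1) : ∃ v ∈ C (2 * m * n), |f y| ≤ meshConst m * |f v| := by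
  have hg := IsHalfAngle.mvPolynomial_aeval (fun i => IsHalfAngle.affine (a i) (b i) (c i)) p hp
  have hK : 1 ≤ 2 * m * n := Nat.one_le_iff_ne_zero.mpr (by positivity)
  have hNK : (2 * n : ℝ) * m = (2 * m * n : ℕ) := by push_cast; ring
  rcases hα with hα | rfl
  · refine (hg.hasChebyshevGrowth_arc hα (F := fun x => f (Real.cos x))
      fun x => ?_).exists_chebyshev_node (by positivity) (fun x => ?_) hm hC hK hNK
      (fun _ _ => rfl) hy
    · rw [hf _ (Real.cos_mem_Icc x), ofReal_eval]
      push_cast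
      rfl
    · refine ⟨Real.arccos (Real.cos x), ⟨Real.arccos_nonneg _, Real.arccos_le_pi _⟩, ?_⟩
      rw [Real.cos_arccos (Real.neg_one_le_cos x) (Real.cos_le_one x)]
  · refine (hg.hasChebyshevGrowth_circle (F := fun x => MvPolynomial.eval (fun i =>
      a i + b i * (1 - 2 * Real.cos x ^ 2) + c i * (2 * Real.cos x * Real.sin x)) p)
      fun x => ?_).exists_chebyshev_node (by positivity) (fun x => ?_) hm hC hK hNK
      (fun x hx => ?_) hy
    · rw [ofReal_eval]
      push_cast
      rfl
    · have hper : Function.Periodic (fun x => MvPolynomial.eval (fun i =>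
          a i + b i * (1 - 2 * Real.cos x ^ 2) + c i * (2 * Real.cos x * Real.sin x)) p)
          Real.pi := fun x => by
        simp only [Real.cos_add_pi, Real.sin_add_pi, neg_sq, mul_neg, neg_mul, neg_neg]
      obtain ⟨z, hz, hxz⟩ := hper.exists_mem_Ico₀ Real.pi_pos x
      exact ⟨z, Set.Ico_subset_Icc_self hz, hxz.symm⟩
    · have h1 : Real.sqrt (1 - Real.cos x ^ 2) = Real.sin x := by
        rw [← Real.sin_sq, Real.sqrt_sq (Real.sin_nonneg_of_mem_Icc hx)]
      rw [hf _ (Real.cos_mem_Icc x)]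
      simp only [one_mul, h1]

/-! ### Dependence of the parametrisation on a single coordinate -/

theorem sphericalMap_update_zero {d : ℕ} [NeZero d] (t : Fin d → ℝ) (s : ℝ) (i : Fin d) :
    sphericalMap (Function.update t 0 s) i = sphericalMap (Function.update t 0 1) i * s := by
  have h (s' : ℝ) : sphericalMap (Function.update t 0 s') i =
      s' * (∏ k ∈ Finset.Ioc 0 i, Real.sin (t k)) *
      (if h : i.val + 1 < d then Real.cos (t ⟨i.val + 1, h⟩) else 1) := by
    simp only [sphericalMap]
    congr 1
    rw [Function.update_self]
    congr 1
    refine Finset.prod_congr rfl fun k hk => ?_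
    rw [Function.update_of_ne (Finset.mem_Ioc.mp hk).1.ne']
  rw [h, h]
  ring

/-- The angle with index `k` enters coordinate `i` through one sine if `k ≤ i`, one cosine if `k = i
+ 1`, and not at all otherwise. -/
theorem exists_sphericalMap_update {d : ℕ} [NeZero d] (t : Fin d → ℝ) {k : Fin d} (hk : k ≠ 0) :
    ∃ a b c : Fin d → ℝ, ∀ s i, sphericalMap (Function.update t k s) i =
      a i + b i * Real.cos s + c i * Real.sin s := by
  have key : ∀ i, ∃ a b c : ℝ, ∀ s, sphericalMap (Function.update t k s) i =
      a + b * Real.cos s + c * Real.sin s := by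
    intro i
    have h0 : ∀ s, Function.update t k s 0 = t 0 := fun s => Function.update_of_ne hk.symm _ _
    by_cases hki : k ≤ i
    · have hmem : k ∈ Finset.Ioc 0 i := Finset.mem_Ioc.mpr ⟨Fin.pos_iff_ne_zero.mpr hk, hki⟩
      refine ⟨0, 0, t 0 * (∏ x ∈ (Finset.Ioc 0 i).erase k, Real.sin (t x)) *
        (if h : i.val + 1 < d then Real.cos (t ⟨i.val + 1, h⟩) else 1), fun s => ?_⟩
      simp only [sphericalMap, h0]
      rw [← Finset.mul_prod_erase _ _ hmem, Function.update_self,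
        Finset.prod_congr rfl (g := fun x => Real.sin (t x)) fun x hx => by
          rw [Function.update_of_ne (Finset.ne_of_mem_erase hx)]]
      have : (if h : i.val + 1 < d then Real.cos (Function.update t k s ⟨i.val + 1, h⟩) else 1) =
          (if h : i.val + 1 < d then Real.cos (t ⟨i.val + 1, h⟩) else 1) := by
        split_ifs with h
        · rw [Function.update_of_ne]
          rintro rfl
          simp [Fin.le_def] at hki
        · rfl
      rw [this]
      ring
    · have hprod : ∀ s, ∏ x ∈ Finset.Ioc 0 i, Real.sin (Function.update t k s x) =
          ∏ x ∈ Finset.Ioc 0 i, Real.sin (t x) := fun s =>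
        Finset.prod_congr rfl fun x hx => by
          rw [Function.update_of_ne]
          rintro rfl
          exact hki (Finset.mem_Ioc.mp hx).2
      by_cases hk1 : k.val = i.val + 1
      · have hlt : i.val + 1 < d := hk1 ▸ k.isLt
        refine ⟨0, t 0 * ∏ x ∈ Finset.Ioc 0 i, Real.sin (t x), 0, fun s => ?_⟩
        have hkk : (⟨i.val + 1, hlt⟩ : Fin d) = k := Fin.ext hk1.symm
        simp only [sphericalMap, h0, hprod, dif_pos hlt, hkk, Function.update_self]
        ring
      · refine ⟨sphericalMap t i, 0, 0, fun s => ?_⟩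
        simp only [sphericalMap, h0, hprod, zero_mul, add_zero]
        congr 1
        split_ifs with h
        · rw [Function.update_of_ne]
          rintro rfl
          simp at hk1
        · rfl
  choose a b c h using key
  exact ⟨a, b, c, fun s i => h i s⟩

theorem boxMap_update {d : ℕ} [NeZero d] (u : Fin d → ℝ) (k : Fin d) (y : ℝ) :
    boxMap (Function.update u k y) = Function.update (boxMap u) k
      (if k = 0 then y / 2 + 1 / 2 else if k.val + 1 < d then sigma 0 Real.pi y
        else sigma 0 (2 * Real.pi) y) := by
  ext i
  rcases eq_or_ne i k with rfl | h
  · simp [boxMap]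
  · simp [boxMap, Function.update_of_ne h]

theorem cos_two_mul_arcsin_add {v : ℝ} (hv : |v| ≤ 1) (c : ℝ) :
    Real.cos (2 * Real.arcsin v + c) = Real.cos c * (1 - 2 * v ^ 2) -
      Real.sin c * (2 * v * Real.sqrt (1 - v ^ 2)) := by
  have h := abs_le.mp hv
  rw [Real.cos_add, Real.cos_two_mul, Real.sin_two_mul, Real.sin_arcsin h.1 h.2, Real.cos_arcsin,
    Real.sq_sqrt (by nlinarith)]
  ring

theorem sin_two_mul_arcsin_add {v : ℝ} (hv : |v| ≤ 1) (c : ℝ) :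
    Real.sin (2 * Real.arcsin v + c) = Real.sin c * (1 - 2 * v ^ 2) +
      Real.cos c * (2 * v * Real.sqrt (1 - v ^ 2)) := by
  have h := abs_le.mp hv
  rw [Real.sin_add, Real.cos_two_mul, Real.sin_two_mul, Real.sin_arcsin h.1 h.2, Real.cos_arcsin,
    Real.sq_sqrt (by nlinarith)]
  ring

theorem exists_node_sigma {d : ℕ} [NeZero d] {p : MvPolynomial (Fin d) ℝ} {n : ℕ} (hn : 1 ≤ n)
    (hp : p.totalDegree ≤ n) {m : ℕ} (hm : 1 < m) {C : ℕ → Set ℝ}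
    (hC : C = chebyshevPoints ∨ C = chebyshevLobattoPoints) (t : Fin d → ℝ) {k : Fin d}
    (hk : k ≠ 0) {b : ℝ} (hα : |Real.sin (b / 4)| < 1 ∨ Real.sin (b / 4) = 1) {y : ℝ}
    (hy : y ∈ Set.Icc (-1) 1) : ∃ v ∈ C (2 * m * n),
      |polyFun p (sphericalMap (Function.update t k (sigma 0 b y)))| ≤
        meshConst m * |polyFun p (sphericalMap (Function.update t k (sigma 0 b v)))| := by
  obtain ⟨A, B, D, h⟩ := exists_sphericalMap_update t hk
  -- Expanding `cos` and `sin` of `2 * arcsin (α * y) + b / 2` rotates the coefficients by `b / 2`,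
  -- with `α = sin (b / 4)`.
  refine exists_chebyshev_node_arc hn hp A
    (fun i => B i * Real.cos (b / 2) + D i * Real.sin (b / 2))
    (fun i => D i * Real.cos (b / 2) - B i * Real.sin (b / 2)) hm hC hα (f := fun y =>
      polyFun p (sphericalMap (Function.update t k (sigma 0 b y)))) (fun y hy => ?_) hy
  have hv : |Real.sin (b / 4) * y| ≤ 1 := by
    rw [abs_mul]
    exact mul_le_one₀ (Real.abs_sin_le_one _) (abs_nonneg _) (abs_le.mpr hy)
  simp only [polyFun, h]
  congr 2
  ext i
  rw [sigma, sub_zero, add_zero, cos_two_mul_arcsin_add hv, sin_two_mul_arcsin_add hv]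
  ring

open Polynomial in
theorem exists_node_radius {d : ℕ} [NeZero d] {p : MvPolynomial (Fin d) ℝ} {n : ℕ} (hn : 1 ≤ n)
    (hp : p.totalDegree ≤ n) {m : ℕ} (hm : 1 < m) {C : ℕ → Set ℝ}
    (hC : C = chebyshevPoints ∨ C = chebyshevLobattoPoints) (t : Fin d → ℝ) {y : ℝ}
    (hy : y ∈ Set.Icc (-1) 1) : ∃ v ∈ C (m * n),
      |polyFun p (sphericalMap (Function.update t 0 (y / 2 + 1 / 2)))| ≤
        meshConst m * |polyFun p (sphericalMap (Function.update t 0 (v / 2 + 1 / 2)))| := by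
  -- The point at radius `y / 2 + 1 / 2` is `a * y + a`, with `a` half the direction vector.
  set a : Fin d → ℝ := fun i => sphericalMap (Function.update t 0 1) i / 2 with ha
  have hdeg := MvPolynomial.aeval_natDegree_le p hp
    (fun i => (Polynomial.C (a i) * X + Polynomial.C (a i) : ℝ[X])) (fun i => natDegree_linear_le)
  rw [mul_one] at hdeg
  refine (hasChebyshevGrowth_eval_cos _ hdeg).exists_chebyshev_node (Nat.cast_nonneg _)
    (fun x => ?_) hm hC (Nat.one_le_iff_ne_zero.mpr (by positivity)) (by push_cast; ring)
    (f := fun y => polyFun p (sphericalMap (Function.update t 0 (y / 2 + 1 / 2))))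
    (fun x _ => ?_) hy
  · refine ⟨Real.arccos (Real.cos x), ⟨Real.arccos_nonneg _, Real.arccos_le_pi _⟩, ?_⟩
    rw [Real.cos_arccos (Real.neg_one_le_cos x) (Real.cos_le_one x)]
  · simp only [polyFun, sphericalMap_update_zero t (_ / 2 + 1 / 2)]
    rw [← coe_aeval_eq_eval, MvPolynomial.comp_aeval_apply, ← MvPolynomial.coe_aeval_eq_eval]
    simp only [coe_aeval_eq_eval, RingHom.coe_coe]
    congr 2
    ext i
    simp only [eval_add, eval_mul, eval_X, eval_C, ha]
    ring

/-- Replacing one coordinate of the cube by a suitable node loses at most a factor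
`meshConst m`. -/
theorem exists_update_node {d : ℕ} [NeZero d] {p : MvPolynomial (Fin d) ℝ} {n : ℕ} (hn : 1 ≤ n)
    (hp : p.totalDegree ≤ n) {m : ℕ} (hm : 1 < m) {C : ℕ → Set ℝ}
    (hC : C = chebyshevPoints ∨ C = chebyshevLobattoPoints) (u : Fin d → ℝ) (k : Fin d)
    (hu : u k ∈ Set.Icc (-1) 1) : ∃ v ∈ C (if k = 0 then m * n else 2 * m * n),
      |polyFun p (ballMap u)| ≤
        meshConst m * |polyFun p (ballMap (Function.update u k v))| := by
  have hu' : ballMap u = ballMap (Function.update u k (u k)) := by rw [Function.update_eq_self]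
  rw [hu']
  simp only [ballMap, boxMap_update]
  by_cases hk : k = 0
  · subst hk
    simp only [if_true]
    exact exists_node_radius hn hp hm hC (boxMap u) hu
  · simp only [if_neg hk]
    split_ifs with hd
    · refine exists_node_sigma hn hp hm hC (boxMap u) hk (Or.inl ?_) hu
      have h1 : 0 < Real.sin (Real.pi / 4) :=
        Real.sin_pos_of_pos_of_lt_pi (by positivity) (by linarith [Real.pi_pos])
      rw [abs_of_pos h1, ← Real.sin_pi_div_two]
      exact Real.sin_lt_sin_of_lt_of_le_pi_div_two (by linarith [Real.pi_pos]) le_rfl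
        (by linarith [Real.pi_pos])
    · refine exists_node_sigma hn hp hm hC (boxMap u) hk (Or.inr ?_) hu
      rw [show 2 * Real.pi / 4 = Real.pi / 2 by ring, Real.sin_pi_div_two]

/-- Iterating a coordinatewise estimate over a cube. -/
theorem exists_mem_grid {d : ℕ} {f : (Fin d → ℝ) → ℝ} {c : ℝ} (hc : 0 ≤ c) {I : Set ℝ}
    {A : Fin d → Set ℝ} (hA : ∀ k, A k ⊆ I)
    (h : ∀ u k, u k ∈ I → ∃ v ∈ A k, |f u| ≤ c * |f (Function.update u k v)|) {u : Fin d → ℝ}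
    (hu : ∀ k, u k ∈ I) : ∃ g : Fin d → ℝ, (∀ k, g k ∈ A k) ∧ |f u| ≤ c ^ d * |f g| := by
  have key : ∀ s : Finset (Fin d), ∃ g : Fin d → ℝ, (∀ k ∈ s, g k ∈ A k) ∧ (∀ k, g k ∈ I) ∧
      |f u| ≤ c ^ s.card * |f g| := by
    intro s
    induction s using Finset.induction_on with
    | empty => exact ⟨u, by simp, hu, by simp⟩
    | insert k s hk ih =>
      obtain ⟨g, hg, hgI, hle⟩ := ih
      obtain ⟨v, hv, hfv⟩ := h g k (hgI k)
      refine ⟨Function.update g k v, fun j hj => ?_, fun j => ?_, ?_⟩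
      · rcases eq_or_ne j k with rfl | hjk
        · rwa [Function.update_self]
        · rw [Function.update_of_ne hjk]
          exact hg j ((Finset.mem_insert.mp hj).resolve_left hjk)
      · rcases eq_or_ne j k with rfl | hjk
        · rw [Function.update_self]; exact hA _ hv
        · rw [Function.update_of_ne hjk]; exact hgI j
      · rw [Finset.card_insert_of_notMem hk, pow_succ, mul_assoc]
        exact hle.trans (mul_le_mul_of_nonneg_left hfv (pow_nonneg hc _))
  obtain ⟨g, hg, -, hle⟩ := key Finset.univ
  exact ⟨g, fun k => hg k (Finset.mem_univ k), by simpa using hle⟩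

/-! ### Spherical coordinates cover the ball -/

/-- Extension by zero of a vector to all natural indices. -/
def extendNat {d : ℕ} (t : Fin d → ℝ) (j : ℕ) : ℝ := if h : j < d then t ⟨j, h⟩ else 0

theorem extendNat_val {d : ℕ} (t : Fin d → ℝ) (i : Fin d) : extendNat t i = t i := by
  simp [extendNat]

theorem sphericalMap_apply {d : ℕ} [NeZero d] (t : Fin d → ℝ) (i : Fin d) :
    sphericalMap t i = t 0 * (∏ k ∈ Finset.Ioc 0 i.val, Real.sin (extendNat t k)) *
      (if i.val + 1 < d then Real.cos (extendNat t (i.val + 1)) else 1) := by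
  have h1 : ∏ k ∈ Finset.Ioc 0 i.val, Real.sin (extendNat t k) =
      ∏ k ∈ Finset.Ioc 0 i, Real.sin (t k) := by
    have := Fin.map_valEmbedding_Ioc 0 i
    rw [Fin.val_zero] at this
    rw [← this, Finset.prod_map]
    exact Finset.prod_congr rfl fun k _ => by rw [Fin.valEmbedding_apply, extendNat_val]
  rw [h1]
  simp only [sphericalMap]
  congr 1
  split_ifs with h
  · simp [extendNat, h]
  · rfl

theorem norm_sphericalMap {d : ℕ} [NeZero d] (t : Fin d → ℝ) : ‖sphericalMap t‖ = |t 0| := by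
  obtain ⟨e, rfl⟩ := Nat.exists_eq_succ_of_ne_zero (NeZero.ne d)
  -- The squares telescope through `sin ^ 2 + cos ^ 2 = 1`; the last coordinate, having no cosine,
  -- supplies the remaining term.
  have h : ∀ j ≤ e, ∑ i ∈ Finset.range j,
      (t 0 * (∏ k ∈ Finset.Ioc 0 i, Real.sin (extendNat t k)) *
        (if i + 1 < e + 1 then Real.cos (extendNat t (i + 1)) else 1)) ^ 2 =
      t 0 ^ 2 * (1 - (∏ k ∈ Finset.Ioc 0 j, Real.sin (extendNat t k)) ^ 2) := by
    intro j hj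
    induction j with
    | zero => simp
    | succ j ih =>
      rw [Finset.sum_range_succ, ih (by omega), if_pos (by omega),
        Finset.prod_Ioc_succ_top (Nat.zero_le j)]
      linear_combination (t 0 * ∏ k ∈ Finset.Ioc 0 j, Real.sin (extendNat t k)) ^ 2 *
        Real.sin_sq_add_cos_sq (extendNat t (j + 1))
  rw [EuclideanSpace.norm_eq, ← Real.sqrt_sq_eq_abs]
  congr 1
  simp only [Real.norm_eq_abs, sq_abs, sphericalMap_apply]
  rw [Fin.sum_univ_eq_sum_range (fun i => (t 0 * (∏ k ∈ Finset.Ioc 0 i, Real.sin (extendNat t k)) *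
        (if i + 1 < e + 1 then Real.cos (extendNat t (i + 1)) else 1)) ^ 2) (e + 1),
    Finset.sum_range_succ, h e le_rfl, if_neg (lt_irrefl _)]
  ring

theorem exists_polar_of_nonneg (a : ℝ) {b : ℝ} (hb : 0 ≤ b) : ∃ θ ∈ Set.Icc 0 Real.pi,
    Real.sqrt (a ^ 2 + b ^ 2) * Real.cos θ = a ∧ Real.sqrt (a ^ 2 + b ^ 2) * Real.sin θ = b := by
  refine ⟨Real.arccos (a / Real.sqrt (a ^ 2 + b ^ 2)),
    ⟨Real.arccos_nonneg _, Real.arccos_le_pi _⟩, ?_⟩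
  rcases (Real.sqrt_nonneg (a ^ 2 + b ^ 2)).eq_or_lt with h | h
  · have h0 : a ^ 2 + b ^ 2 = 0 :=
      le_antisymm (Real.sqrt_eq_zero'.mp h.symm) (by positivity)
    have ha : a = 0 := by nlinarith
    have hb : b = 0 := by nlinarith
    simp [ha, hb]
  · have hpos : 0 < a ^ 2 + b ^ 2 := Real.sqrt_pos.mp h
    have hle := abs_le.mp (Real.abs_le_sqrt (show a ^ 2 ≤ a ^ 2 + b ^ 2 by nlinarith))
    rw [Real.cos_arccos (by rw [le_div_iff₀ h]; linarith) (by rw [div_le_one h]; exact hle.2),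
      Real.sin_arccos, ← Real.sqrt_mul hpos.le, div_pow, Real.sq_sqrt hpos.le]
    refine ⟨mul_div_cancel₀ _ h.ne', ?_⟩
    rw [mul_sub, mul_div_cancel₀ _ hpos.ne', mul_one, add_sub_cancel_left, Real.sqrt_sq hb]

theorem exists_polar (a b : ℝ) : ∃ θ ∈ Set.Icc 0 (2 * Real.pi),
    Real.sqrt (a ^ 2 + b ^ 2) * Real.cos θ = a ∧ Real.sqrt (a ^ 2 + b ^ 2) * Real.sin θ = b := by
  rcases le_total 0 b with hb | hb
  · obtain ⟨θ, hθ, h⟩ := exists_polar_of_nonneg a hb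
    exact ⟨θ, ⟨hθ.1, by linarith [hθ.2, Real.pi_pos]⟩, h⟩
  · obtain ⟨θ, hθ, h1, h2⟩ := exists_polar_of_nonneg a (neg_nonneg.mpr hb)
    rw [neg_sq] at h1 h2
    refine ⟨2 * Real.pi - θ, ⟨by linarith [hθ.2, Real.pi_pos], by linarith [hθ.1]⟩, ?_, ?_⟩
    · rw [Real.cos_two_pi_sub, h1]
    · rw [Real.sin_two_pi_sub, mul_neg, h2, neg_neg]

/-- With `ρ j` the norm of the tail of `x` from index `j`, each angle but the last is the polar
angle of `(X j, ρ (j + 1))`, in `[0, π]` because `ρ ≥ 0`. The last uses the signed pair of final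
coordinates, hence `[0, 2π]`. -/
theorem exists_sphericalMap_eq {d : ℕ} [NeZero d] (hd : 2 ≤ d) (x : EuclideanSpace ℝ (Fin d)) :
    ∃ t : Fin d → ℝ, t 0 = ‖x‖ ∧
      (∀ k : Fin d, k ≠ 0 → k.val + 1 < d → t k ∈ Set.Icc 0 Real.pi) ∧
      (∀ k : Fin d, k ≠ 0 → ¬ k.val + 1 < d → t k ∈ Set.Icc 0 (2 * Real.pi)) ∧
      sphericalMap t = x := by
  set X : ℕ → ℝ := extendNat x with hX
  set ρ : ℕ → ℝ := fun j => Real.sqrt (∑ i ∈ Finset.Ico j d, X i ^ 2) with hρ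
  have hρ0 : ρ 0 = ‖x‖ := by
    rw [hρ, EuclideanSpace.norm_eq]
    simp only [Real.norm_eq_abs, sq_abs]
    rw [← Finset.range_eq_Ico, ← Fin.sum_univ_eq_sum_range (fun i => X i ^ 2)]
    simp only [hX, extendNat_val]
  have hρs : ∀ j < d, ρ j = Real.sqrt (X j ^ 2 + ρ (j + 1) ^ 2) := fun j hj => by
    simp only [hρ]
    rw [Real.sq_sqrt (Finset.sum_nonneg fun i _ => sq_nonneg _),
      Finset.sum_eq_sum_Ico_succ_bot hj]
  have hlast : ρ (d - 2) = Real.sqrt (X (d - 2) ^ 2 + X (d - 1) ^ 2) := by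
    simp only [hρ]
    rw [Finset.sum_eq_sum_Ico_succ_bot (by omega), show d - 2 + 1 = d - 1 by omega,
      Finset.sum_eq_sum_Ico_succ_bot (by omega), show d - 1 + 1 = d by omega, Finset.Ico_self,
      Finset.sum_empty, add_zero]
  have hangle : ∀ j : ℕ, ∃ θ : ℝ, j + 2 < d → θ ∈ Set.Icc 0 Real.pi ∧
      ρ j * Real.cos θ = X j ∧ ρ j * Real.sin θ = ρ (j + 1) := fun j => by
    by_cases hj : j + 2 < d
    · obtain ⟨θ, hθ, h⟩ := exists_polar_of_nonneg (X j) (Real.sqrt_nonneg _ : 0 ≤ ρ (j + 1))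
      rw [← hρs j (by omega)] at h
      exact ⟨θ, fun _ => ⟨hθ, h⟩⟩
    · exact ⟨0, fun h => absurd h hj⟩
  choose φ hφ using hangle
  obtain ⟨ω, hω, hωc, hωs⟩ := exists_polar (X (d - 2)) (X (d - 1))
  rw [← hlast] at hωc hωs
  set t : Fin d → ℝ := fun k => if k.val = 0 then ‖x‖ else if k.val + 1 < d then φ (k.val - 1)
    else ω with ht
  have ht0 : t 0 = ‖x‖ := by simp [ht]
  have htφ : ∀ j, j + 2 < d → extendNat t (j + 1) = φ j := fun j hj => by
    simp [extendNat, ht, show j + 1 < d by omega, show j + 1 + 1 < d by omega]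
  have htω : extendNat t (d - 1) = ω := by
    simp [extendNat, ht, show d - 1 < d by omega, show d - 1 ≠ 0 by omega,
      show ¬ d - 1 + 1 < d by omega]
  have hprod : ∀ j, j + 2 ≤ d → ‖x‖ * ∏ k ∈ Finset.Ioc 0 j, Real.sin (extendNat t k) = ρ j := by
    intro j hj
    induction j with
    | zero => simp [hρ0]
    | succ j ih =>
      rw [Finset.prod_Ioc_succ_top (Nat.zero_le j), ← mul_assoc, ih (by omega), htφ j (by omega)]
      exact (hφ j (by omega)).2.2
  refine ⟨t, ht0, fun k hk hkd => ?_, fun k hk hkd => ?_, ?_⟩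
  · have hk0 : k.val ≠ 0 := fun h => hk (Fin.ext h)
    simp only [ht, if_neg hk0, if_pos hkd]
    exact (hφ _ (by omega)).1
  · have hk0 : k.val ≠ 0 := fun h => hk (Fin.ext h)
    simp only [ht, if_neg hk0, if_neg hkd]
    exact hω
  · ext i
    rw [sphericalMap_apply, ht0]
    have hi := i.isLt
    have hxi : x i = X i := (extendNat_val x i).symm
    rw [hxi]
    rcases lt_trichotomy (i.val + 2) d with h | h | h
    · rw [hprod _ h.le, if_pos (by omega), htφ _ h]
      exact (hφ _ h).2.1
    · rw [hprod _ h.le, if_pos (by omega), show i.val + 1 = d - 1 by omega, htω,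
        show i.val = d - 2 by omega]
      exact hωc
    · have hi' : i.val = d - 2 + 1 := by omega
      rw [if_neg (by omega), mul_one, hi', Finset.prod_Ioc_succ_top (Nat.zero_le _), ← mul_assoc,
        hprod _ (by omega), show d - 2 + 1 = d - 1 by omega, htω]
      exact hωs

/-- Solving for `u` works because `|θ - b / 2| / 2 ≤ b / 4 ≤ π / 2`, where `sin` is increasing and
inverted by `arcsin`. -/
theorem exists_sigma_eq {b θ : ℝ} (hb : 0 < b) (hb' : b ≤ 2 * Real.pi) (hθ : θ ∈ Set.Icc 0 b) :
    ∃ u ∈ Set.Icc (-1 : ℝ) 1, sigma 0 b u = θ := by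
  have hs : 0 < Real.sin (b / 4) :=
    Real.sin_pos_of_pos_of_lt_pi (by linarith) (by linarith [Real.pi_pos])
  refine ⟨Real.sin ((θ - b / 2) / 2) / Real.sin (b / 4), ⟨?_, ?_⟩, ?_⟩
  · rw [le_div_iff₀ hs, neg_one_mul, ← Real.sin_neg]
    exact Real.sin_le_sin_of_le_of_le_pi_div_two (by linarith) (by linarith [hθ.2])
      (by linarith [hθ.1])
  · rw [div_le_one hs]
    exact Real.sin_le_sin_of_le_of_le_pi_div_two (by linarith [hθ.1]) (by linarith)
      (by linarith [hθ.2])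
  · rw [sigma, sub_zero, mul_div_cancel₀ _ hs.ne',
      Real.arcsin_sin (by linarith [hθ.1]) (by linarith [hθ.2])]
    ring

theorem exists_ballMap_eq {d : ℕ} [NeZero d] (hd : 2 ≤ d) {x : EuclideanSpace ℝ (Fin d)}
    (hx : ‖x‖ ≤ 1) : ∃ u : Fin d → ℝ, (∀ k, u k ∈ Set.Icc (-1) 1) ∧ ballMap u = x := by
  obtain ⟨t, ht0, htπ, ht2, hst⟩ := exists_sphericalMap_eq hd x
  have key : ∀ k, ∃ y ∈ Set.Icc (-1 : ℝ) 1, (if k = 0 then y / 2 + 1 / 2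
      else if k.val + 1 < d then sigma 0 Real.pi y else sigma 0 (2 * Real.pi) y) = t k := by
    intro k
    by_cases hk : k = 0
    · subst hk
      refine ⟨2 * ‖x‖ - 1, ⟨by linarith [norm_nonneg x], by linarith⟩, ?_⟩
      rw [if_pos rfl, ht0]
      ring
    · simp only [if_neg hk]
      split_ifs with hkd
      · exact exists_sigma_eq Real.pi_pos (by linarith [Real.pi_pos]) (htπ k hk hkd)
      · exact exists_sigma_eq (by positivity) le_rfl (ht2 k hk hkd)
  choose u hu hut using key
  refine ⟨u, hu, ?_⟩
  rw [ballMap, show boxMap u = t from funext hut, hst]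

theorem ballMap_mem_closedBall {d : ℕ} [NeZero d] {u : Fin d → ℝ}
    (hu : u 0 ∈ Set.Icc (-1 : ℝ) 1) :
    ballMap u ∈ Metric.closedBall (0 : EuclideanSpace ℝ (Fin d)) 1 := by
  rw [mem_closedBall_zero_iff, ballMap, norm_sphericalMap]
  simp only [boxMap, if_true]
  exact abs_le.mpr ⟨by linarith [hu.1], by linarith [hu.2]⟩

/-! ### Determining property, cardinality and conclusion -/

theorem isPolynomiallyDetermining_closedBall (d : ℕ) :
    IsPolynomiallyDetermining (Metric.closedBall (0 : EuclideanSpace ℝ (Fin d)) 1) := by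
  intro p hp x
  have hd : (0 : ℝ) < d + 1 := by positivity
  have h0 : p = 0 := by
    -- A box with infinite sides suffices; side `1 / (d + 1)` keeps it in the ball, as the squares
    -- sum to at most `d / (d + 1)`.
    refine MvPolynomial.funext_set (fun _ : Fin d => Set.Icc (0 : ℝ) (1 / (d + 1)))
      (fun _ => Set.Icc_infinite (by positivity)) fun y hy => ?_
    rw [map_zero]
    refine hp (WithLp.toLp 2 y) ?_
    rw [mem_closedBall_zero_iff, EuclideanSpace.norm_eq, Real.sqrt_le_one]
    have hle : ∀ i, ‖y i‖ ^ 2 ≤ 1 / (d + 1 : ℝ) := fun i => by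
      have h1 := hy i (Set.mem_univ i)
      have h2 : 1 / (d + 1 : ℝ) ≤ 1 := by
        rw [div_le_one hd]; linarith [Nat.cast_nonneg (α := ℝ) d]
      rw [Real.norm_eq_abs, sq_abs]
      nlinarith [h1.1, h1.2]
    refine (Finset.sum_le_card_nsmul _ _ _ fun i _ => hle i).trans ?_
    rw [Finset.card_univ, Fintype.card_fin, nsmul_eq_mul, mul_one_div, div_le_one hd]
    linarith
  simp [h0, polyFun]

theorem node_mem_Icc {C : ℕ → Set ℝ} (hC : C = chebyshevPoints ∨ C = chebyshevLobattoPoints)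
    (K : ℕ) : C K ⊆ Set.Icc (-1) 1 := by
  rcases hC with rfl | rfl
  · rintro _ ⟨j, -, -, rfl⟩; exact Real.cos_mem_Icc _
  · rintro _ ⟨j, -, rfl⟩; exact Real.cos_mem_Icc _

theorem exists_finset_nodes {C : ℕ → Set ℝ}
    (hC : C = chebyshevPoints ∨ C = chebyshevLobattoPoints) (K : ℕ) :
    ∃ s : Finset ℝ, s.card ≤ K + 1 ∧ C K ⊆ s := by
  rcases hC with rfl | rfl
  · refine ⟨(Finset.range (K + 1)).image fun j : ℕ =>
      Real.cos ((2 * (j : ℝ) - 1) * Real.pi / (2 * (K : ℝ))),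
      Finset.card_image_le.trans_eq (Finset.card_range _), ?_⟩
    rintro _ ⟨j, -, hj, rfl⟩
    exact Finset.mem_coe.mpr (Finset.mem_image.mpr ⟨j, Finset.mem_range.mpr (by omega), rfl⟩)
  · refine ⟨(Finset.range (K + 1)).image fun j : ℕ => Real.cos ((j : ℝ) * Real.pi / (K : ℝ)),
      Finset.card_image_le.trans_eq (Finset.card_range _), ?_⟩
    rintro _ ⟨j, hj, rfl⟩
    exact Finset.mem_coe.mpr (Finset.mem_image.mpr ⟨j, Finset.mem_range.mpr (by omega), rfl⟩)

theorem nodes_nonempty {C : ℕ → Set ℝ}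
    (hC : C = chebyshevPoints ∨ C = chebyshevLobattoPoints) {K : ℕ} (hK : 1 ≤ K) :
    (C K).Nonempty := by
  rcases hC with rfl | rfl
  · exact ⟨_, 1, le_rfl, hK, rfl⟩
  · exact ⟨_, 0, Nat.zero_le _, rfl⟩

theorem productGrid_eq {d : ℕ} [NeZero d] (C : ℕ → Set ℝ) (m n : ℕ) {u : Fin d → ℝ} :
    u ∈ productGrid (C (m * n)) (C (2 * m * n)) ↔
      ∀ k : Fin d, u k ∈ C (if k = 0 then m * n else 2 * m * n) := by
  refine ⟨fun h k => ?_, fun h => ⟨by simpa using h 0, fun k hk => by simpa [hk] using h k⟩⟩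
  by_cases hk : k = 0
  · subst hk; simpa using h.1
  · simpa [hk] using h.2 k hk

theorem exists_finset_ballMesh {d : ℕ} [NeZero d] {C : ℕ → Set ℝ}
    (hC : C = chebyshevPoints ∨ C = chebyshevLobattoPoints) (m n : ℕ) :
    ∃ s : Finset (EuclideanSpace ℝ (Fin d)), s.card ≤ (2 * m * n + 1) ^ d ∧
      ballMesh d C m n ⊆ s := by
  classical
  choose s hs hCs using exists_finset_nodes hC
  refine ⟨(Fintype.piFinset fun k : Fin d => s (if k = 0 then m * n else 2 * m * n)).image ballMap,
    Finset.card_image_le.trans ?_, ?_⟩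
  · rw [Fintype.card_piFinset]
    refine (Finset.prod_le_pow_card _ _ (2 * m * n + 1) fun k _ => ?_).trans_eq (by simp)
    refine (hs _).trans (Nat.succ_le_succ ?_)
    split_ifs
    · rw [mul_assoc]; exact Nat.le_mul_of_pos_left _ two_pos
    · exact le_rfl
  · rintro _ ⟨u, hu, rfl⟩
    rw [productGrid_eq] at hu
    exact Finset.mem_coe.mpr (Finset.mem_image_of_mem _
      (Fintype.mem_piFinset.mpr fun k => Finset.mem_coe.mp (hCs _ (hu k))))

theorem ncard_ballMesh_isBigO (d : ℕ) [NeZero d] (m : ℕ) {C : ℕ → Set ℝ}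
    (hC : C = chebyshevPoints ∨ C = chebyshevLobattoPoints) :
    Asymptotics.IsBigO Filter.atTop (fun n : ℕ => ((ballMesh d C m n).ncard : ℝ))
      (fun n : ℕ => (n : ℝ) ^ (d : ℝ)) := by
  -- For `n ≥ 1`, `2 * m * n + 1 ≤ (2 * m + 1) * n`.
  refine Asymptotics.IsBigO.of_bound ((2 * m + 1 : ℝ) ^ d) ?_
  filter_upwards [Filter.eventually_ge_atTop 1] with n hn
  obtain ⟨s, hs, hsub⟩ := exists_finset_ballMesh (d := d) hC m n
  have h1 : (ballMesh d C m n).ncard ≤ (2 * m * n + 1) ^ d :=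
    ((Set.ncard_le_ncard hsub s.finite_toSet).trans_eq (Set.ncard_coe_finset s)).trans hs
  have hn' : (1 : ℝ) ≤ n := by exact_mod_cast hn
  rw [Real.rpow_natCast, Real.norm_of_nonneg (by positivity), Real.norm_of_nonneg (by positivity),
    ← mul_pow]
  calc ((ballMesh d C m n).ncard : ℝ) ≤ ((2 * m * n + 1 : ℕ) : ℝ) ^ d := by exact_mod_cast h1
    _ ≤ _ := by
      refine pow_le_pow_left₀ (by positivity) ?_ d
      push_cast
      linarith

theorem meshConst_nonneg {m : ℕ} (hm : 1 < m) : 0 ≤ meshConst m := by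
  have hm' : (1 : ℝ) < m := by exact_mod_cast hm
  have h0 : 0 ≤ Real.pi / (2 * (m : ℝ)) := by positivity
  refine one_div_nonneg.mpr (Real.cos_nonneg_of_neg_pi_div_two_le_of_le ?_ ?_)
  · linarith [Real.pi_pos]
  · exact div_le_div_of_nonneg_left Real.pi_pos.le two_pos (by linarith)

end BallMesh

theorem lemma4 (d : ℕ) [NeZero d] (hd : 2 ≤ d) (m : ℕ) (hm : 1 < m) (C : ℕ → Set ℝ)
    (hC : C = BallMesh.chebyshevPoints ∨ C = BallMesh.chebyshevLobattoPoints) :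
    BallMesh.IsAdmissibleMesh (Metric.closedBall (0 : EuclideanSpace ℝ (Fin d)) 1)
      (fun n => BallMesh.ballMesh d C m n) (BallMesh.meshConst m ^ d) := by
  have hfin : ∀ n, (BallMesh.ballMesh d C m n).Finite := fun n => by
    obtain ⟨s, -, hs⟩ := BallMesh.exists_finset_ballMesh (d := d) hC m n
    exact s.finite_toSet.subset hs
  refine ⟨isCompact_closedBall _ _, BallMesh.isPolynomiallyDetermining_closedBall d,
    fun n _ => hfin n, fun n hn => ?_, fun n _ => ?_, fun n hn p hp => ?_,
    d, le_rfl, BallMesh.ncard_ballMesh_isBigO d m hC⟩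
  · have hne : ∀ k : Fin d, (C (if k = 0 then m * n else 2 * m * n)).Nonempty := fun k =>
      BallMesh.nodes_nonempty hC (by
        split_ifs <;> exact Nat.one_le_iff_ne_zero.mpr (by positivity))
    choose g hg using hne
    exact ⟨_, g, (BallMesh.productGrid_eq C m n).mpr hg, rfl⟩
  · rintro _ ⟨u, hu, rfl⟩
    exact BallMesh.ballMap_mem_closedBall (BallMesh.node_mem_Icc hC _ hu.1)
  · refine csSup_le ⟨_, 0, by simp, rfl⟩ ?_
    rintro _ ⟨x, hx, rfl⟩
    obtain ⟨u, hu, rfl⟩ := BallMesh.exists_ballMap_eq hd (mem_closedBall_zero_iff.mp hx)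
    obtain ⟨g, hg, hle⟩ := BallMesh.exists_mem_grid (BallMesh.meshConst_nonneg hm)
      (f := fun u => BallMesh.polyFun p (BallMesh.ballMap u))
      (A := fun k : Fin d => C (if k = 0 then m * n else 2 * m * n))
      (fun k => BallMesh.node_mem_Icc hC _)
      (fun u k hk => BallMesh.exists_update_node hn hp hm hC u k hk) hu
    refine hle.trans (mul_le_mul_of_nonneg_left ?_ (pow_nonneg (BallMesh.meshConst_nonneg hm) d))
    exact le_csSup ((hfin n).image _).bddAbove
      ⟨_, ⟨g, (BallMesh.productGrid_eq C m n).mpr hg, rfl⟩, rfl⟩
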